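/- **Setting.** Let $U\subseteq\mathbb R^4$ be open (a coordinate chart with coordinates $x^0,\dots,x^3$), let $\hat g$ be a smooth, not necessarily symmetric, metric on $U$ whose symmetric part $g_{\underline{ij}}$ is non-singular, with inverse $g^{\underline{ij}}$, and put $g=\det[g_{\underline{ij}}]$. Let $\Gamma$, $|$, $R^i_{jmn}=\Gamma^i_{jm,n}-\Gamma^i_{jn,m}+\Gamma^\alpha_{jm}\Gamma^i_{\alpha n}-\Gamma^\alpha_{jn}\Gamma^i_{\alpha m}$, $R_{ij}=R^\alpha_{ij\alpha}$ and $R=g^{\underline{ij}}R_{ij}$ be the Christoffel symbols, covariant derivative, curvature, Ricci tensor and scalar curvature of $g_{\underline{ij}}$. Let $\tilde\Gamma^i_{jk}$ be affine connection coefficients, given by any law in terms of $\hat g$ that is smooth along smooth compactly supported variations of $g^{\underline{ij}}$ (with the anti-symmetric part of $\hat g$ fixed). Put $\tilde T^i_{jk}=\tilde\Gamma^i_{jk}-\tilde\Gamma^i_{kj}$, $\tilde T_{ijk}=g_{\underline{i\alpha}}\tilde T^\alpha_{jk}$, $g_{\underline{ij}\underset1|k}=g_{\underline{ij},k}-\tilde\Gamma^\alpha_{ik}g_{\underline{\alpha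 j}}-\tilde\Gamma^\alpha_{jk}g_{\underline{i\alpha}}$, $\eta_{\alpha jk}=\tilde T_{j\alpha k}+\tilde T_{k\alpha j}+g_{\underline{k\alpha}\underset1|j}+g_{\underline{\alpha j}\underset1|k}-g_{\underline{kj}\underset1|\alpha}$ and $\eta^i_{jk}=g^{\underline{i\alpha}}\eta_{\alpha jk}$. For real $u',v',w$ let $$\begin{aligned}\tilde{\mathcal L}[u',v',w]={}&-\tfrac12g^{\underline{\beta\gamma}}\eta^\alpha_{\beta\gamma|\alpha}+\tfrac12g^{\underline{\beta\gamma}}\eta^\alpha_{\alpha\beta|\gamma}+\tfrac14g^{\underline{\gamma\delta}}(\eta^\alpha_{\gamma\delta}\eta^\beta_{\alpha\beta}-\eta^\alpha_{\beta\gamma}\eta^\beta_{\alpha\delta})\\&-(v'+w)g^{\underline{\gamma\delta}}\tilde T^\alpha_{\gamma\beta}\tilde T^\beta_{\delta\alpha}+u'g^{\underline{\beta\gamma}}\tilde T^\alpha_{\beta\alpha|\gamma}+\tfrac{u'}2g^{\underline{\alpha\beta}}g^{\underline{\delta\epsilon}}\eta_{\alpha\delta\epsilon}\tilde T^\gamma_{\beta\gamma}\end{aligned}$$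 be the matter part of the scalar curvature of the generalized Riemannian space in the sense of Ivanov and Zlatanović. Let $\Lambda\in\mathbb R$ and consider the action $\tilde S=\int d^4x\sqrt{|g|}\,(R-2\Lambda+\tilde{\mathcal L}[u',v',w])$. Let the continuous symmetric tensor $\tilde{\mathcal V}_{ij}=\delta\tilde{\mathcal L}[u',v',w]/\delta g^{\underline{ij}}$ be the variational derivative, i.e. $\int d^4x\sqrt{|g|}\,\delta\tilde{\mathcal L}=\int d^4x\sqrt{|g|}\,\tilde{\mathcal V}_{\alpha\beta}\,\delta g^{\underline{\alpha\beta}}$ for all smooth symmetric variations $\delta g^{\underline{ij}}$ with compact support in $U$ (all integrals, including those of the action, are taken over an arbitrary compact subset of $U$ containing that support). The energy-momentum tensor is the continuous symmetric tensor $\tilde T_{ij}$ with $\delta\int d^4x\sqrt{|g|}\,\tilde{\mathcal L}=-\int d^4x\sqrt{|g|}\,\tilde T_{\alpha\beta}\,\delta g^{\underline{\alpha\beta}}$ for all such variations. For $u^i$ with $u^\alpha u_\alpha=1$, the energy-density, pressure and state parameter are $\rho=\tilde T_{\alpha\beta}u^\alpha u^\beta$, $p=\frac13\Pi^\alpha_\alpha$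 with $\Pi_{ij}=-\tilde T_{\alpha\beta}h^\alpha_ih^\beta_j$, $h^k_i=\delta^k_i-u_iu^k$, and $\omega=p\rho^{-1}$. The comoving frame is $u^i=\delta^i_0$, normalized so that $g_{\underline{00}}=1$; quantities in it carry a subscript $0$. **Theorem.** 1. The action $\tilde S$ is stationary under all these variations if and only if, on $U$, $$R_{ij}-\tfrac12Rg_{\underline{ij}}+\Lambda g_{\underline{ij}}=-\tilde{\mathcal V}_{ij}+\tfrac12g_{\underline{ij}}\tilde{\mathcal L}[u',v',w].\qquad(\ast)$$ 2. The energy-momentum tensor exists; it and its trace are $$\tilde T_{ij}=-\tilde{\mathcal V}_{ij}+\tfrac12g_{\underline{ij}}\tilde{\mathcal L}[u',v',w],\qquad \tilde T^\alpha_\alpha=-\tilde{\mathcal V}^\alpha_\alpha+2\tilde{\mathcal L}[u',v',w].$$ 3. In a frame $u^i$, $$p=\tfrac13\tilde{\mathcal V}^\alpha_\alpha-\tfrac13\tilde{\mathcal V}_{\alpha\beta}u^\alpha u^\beta-\tfrac12\tilde{\mathcal L},\qquad \rho=-\tilde{\mathcal V}_{\alpha\beta}u^\alpha u^\beta+\tfrac12\tilde{\mathcal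 L},$$ and, where $\rho\ne0$, $\omega=-\tfrac13\big(-\tilde{\mathcal V}^\alpha_\alpha+2\tilde{\mathcal L}\big)\big(-\tilde{\mathcal V}_{\alpha\beta}u^\alpha u^\beta+\tfrac12\tilde{\mathcal L}\big)^{-1}+\tfrac13$. In the comoving frame, $$p_0=\tfrac13\tilde{\mathcal V}^\alpha_\alpha-\tfrac13\tilde{\mathcal V}_{00}-\tfrac12\tilde{\mathcal L},\qquad\rho_0=-\tilde{\mathcal V}_{00}+\tfrac12g_{\underline{00}}\tilde{\mathcal L},$$ and, where $\rho_0\ne0$, $\omega_0=-\tfrac13\big(-\tilde{\mathcal V}^\alpha_\alpha+2\tilde{\mathcal L}\big)\big(-\tilde{\mathcal V}_{00}+\tfrac12g_{\underline{00}}\tilde{\mathcal L}\big)^{-1}+\tfrac13$. 4. If the equations of motion $(\ast)$ hold, then the equations of equilibrium for the metric with respect to the pressure ($p$EQM) and the energy-density ($\rho$EQM) are $$\tfrac13R_{\alpha\beta}u^\alpha u^\beta+\tfrac16R-\Lambda=\tfrac13\tilde{\mathcal V}^\alpha_\alpha-\tfrac13\tilde{\mathcal V}_{\alpha\beta}u^\alpha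 u^\beta-\tfrac12\tilde{\mathcal L}[u',v',w],$$ $$R_{\alpha\beta}u^\alpha u^\beta-\tfrac12R+\Lambda=-\tilde{\mathcal V}_{\alpha\beta}u^\alpha u^\beta+\tfrac12\tilde{\mathcal L}[u',v',w]$$ in every frame $u^i$ with $u^\alpha u_\alpha=1$, and $$\tfrac13R_{00}+\tfrac16R-\Lambda=\tfrac13\tilde{\mathcal V}^\alpha_\alpha-\tfrac13\tilde{\mathcal V}_{00}-\tfrac12\tilde{\mathcal L}[u',v',w],$$ $$R_{00}-\tfrac12R+\Lambda=-\tilde{\mathcal V}_{00}+\tfrac12g_{\underline{00}}\tilde{\mathcal L}[u',v',w]$$ in the comoving frame. -/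

import Mathlib

open scoped ContDiff
open MeasureTheory

noncomputable section

namespace GenRiem

/-- Points of a coordinate chart, with coordinates `x 0, x 1, x 2, x 3`. -/
abbrev Point : Type := Fin 4 → ℝ

/-- Fields of `4 × 4` arrays: components of type-`(0,2)` (or `(2,0)`) tensor fields. -/
abbrev Field2 : Type := Point → Matrix (Fin 4) (Fin 4) ℝ

/-- Fields of components with one upper index (first) and two lower indices. -/
abbrev Field3 : Type := Point → Fin 4 → Fin 4 → Fin 4 → ℝ

/-- Partial derivative `∂f/∂x^k`. -/
def pd (k : Fin 4) (f : Point → ℝ) (x : Point) : ℝ :=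
  fderiv ℝ f x (Pi.single k 1)

/-! ### The symmetric part of the metric and its Riemannian geometry -/

/-- The symmetric part of a non-symmetric metric. -/
def symPart (G : Field2) : Field2 := fun x => (1 / 2 : ℝ) • (G x + (G x).transpose)

/-- A smooth (not necessarily symmetric) metric on `U` with non-singular symmetric part. -/
structure IsGeneralizedMetric (U : Set Point) (G : Field2) : Prop where
  smooth : ∀ i j, ContDiffOn ℝ ∞ (fun x => G x i j) U
  nondegenerate : ∀ x ∈ U, (symPart G x).det ≠ 0

/-- `√|det g|`. -/
def volDensity (g : Field2) (x : Point) : ℝ := Real.sqrt |(g x).det|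

/-- Christoffel symbols of the second kind `Γ^i_{jk}` of a symmetric metric. -/
def christoffel (g : Field2) : Field3 := fun x i j k =>
  (1 / 2) * ∑ a, (g x)⁻¹ i a *
    (pd k (fun y => g y j a) x - pd a (fun y => g y j k) x + pd j (fun y => g y a k) x)

/-- `R^i_{jmn} = Γ^i_{jm,n} - Γ^i_{jn,m} + Γ^a_{jm} Γ^i_{an} - Γ^a_{jn} Γ^i_{am}`. -/
def riemann (g : Field2) (x : Point) (i j m n : Fin 4) : ℝ :=
  pd n (fun y => christoffel g y i j m) x - pd m (fun y => christoffel g y i j n) x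
    + ∑ a, christoffel g x a j m * christoffel g x i a n
    - ∑ a, christoffel g x a j n * christoffel g x i a m

/-- Ricci curvature `R_{ij} = R^a_{ija}`. -/
def ricci (g : Field2) (x : Point) (i j : Fin 4) : ℝ := ∑ a, riemann g x a i j a

/-- Scalar curvature `R = g^{ij} R_{ij}`. -/
def scalarCurv (g : Field2) (x : Point) : ℝ := ∑ i, ∑ j, (g x)⁻¹ i j * ricci g x i j

/-- The covariant derivative `A^i_{jk|n}` for the Christoffel symbols of `g`. -/
def covDeriv (g : Field2) (A : Field3) (x : Point) (i j k n : Fin 4) : ℝ :=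
  pd n (fun y => A y i j k) x + ∑ a, christoffel g x i a n * A x a j k
    - ∑ a, christoffel g x a j n * A x i a k - ∑ a, christoffel g x a k n * A x i j a

/-! ### The connection with torsion and the matter Lagrangian

`C x i j k` are the coefficients of an affine connection, the last index being the direction of
differentiation. -/

/-- Torsion `T^i_{jk}`. -/
def torsion (C : Field3) : Field3 := fun x i j k => C x i j k - C x i k j

/-- Covariant torsion `T_{ijk} = g_{ia} T^a_{jk}`. -/
def torsionLow (g : Field2) (C : Field3) (x : Point) (i j k : Fin 4) : ℝ :=
  ∑ a, g x i a * torsion C x a j k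

/-- The covariant derivative of `g_{ij}` in direction `k` for the connection `C`. -/
def nonmetricity (g : Field2) (C : Field3) (x : Point) (i j k : Fin 4) : ℝ :=
  pd k (fun y => g y i j) x - ∑ a, C x a i k * g x a j - ∑ a, C x a j k * g x i a

/-- `η^i_{jk}` with its upper index lowered to `a`. -/
def etaLow (g : Field2) (C : Field3) (x : Point) (a j k : Fin 4) : ℝ :=
  torsionLow g C x j a k + torsionLow g C x k a j
    + nonmetricity g C x k a j + nonmetricity g C x a j k - nonmetricity g C x k j a

/-- The tensor `η^i_{jk}`. -/
def eta (g : Field2) (C : Field3) : Field3 := fun x i j k =>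
  ∑ a, (g x)⁻¹ i a * etaLow g C x a j k

/-- The matter part of the family of scalar curvatures of `(g, C)`, with coefficients
`u', v', w`. -/
def matterScalar (u' v' w : ℝ) (g : Field2) (C : Field3) (x : Point) : ℝ :=
  -(1 / 2) * (∑ b, ∑ c, (g x)⁻¹ b c * ∑ a, covDeriv g (eta g C) x a b c a)
    + (1 / 2) * (∑ b, ∑ c, (g x)⁻¹ b c * ∑ a, covDeriv g (eta g C) x a a b c)
    + (1 / 4) * (∑ c, ∑ d, (g x)⁻¹ c d *
        ∑ a, ∑ b, (eta g C x a c d * eta g C x b a b - eta g C x a b c * eta g C x b a d))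
    - (v' + w) * (∑ c, ∑ d, (g x)⁻¹ c d *
        ∑ a, ∑ b, torsion C x a c b * torsion C x b d a)
    + u' * (∑ b, ∑ c, (g x)⁻¹ b c * ∑ a, covDeriv g (torsion C) x a b a c)
    + u' / 2 * (∑ a, ∑ b, ∑ d, ∑ e, (g x)⁻¹ a b * (g x)⁻¹ d e * etaLow g C x a d e *
        ∑ c, torsion C x c b c)

/-- A Lagrangian: it assigns a scalar field to every (non-symmetric) metric. -/
abbrev Lagrangian : Type := Field2 → Point → ℝ

/-- The matter Lagrangian of a space whose connection coefficients are given, in terms of the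
metric, by the law `conn` (a constant law is a connection that is independent of the metric). -/
def matterLagrangian (u' v' w : ℝ) (conn : Field2 → Field3) : Lagrangian :=
  fun G x => matterScalar u' v' w (symPart G) (conn G) x

/-! ### Variations with respect to the contravariant symmetric metric -/

/-- Admissible variations `h^{ij} = δg^{ij}`: smooth, symmetric, with compact support in `U`. -/
structure IsVariation (U : Set Point) (h : Field2) : Prop where
  smooth : ∀ i j, ContDiff ℝ ∞ (fun x => h x i j)
  symm : ∀ x, (h x).IsSymm
  compact : HasCompactSupport h
  support : tsupport h ⊆ U

/-- The metric with the same anti-symmetric part as `G` whose symmetric part has the inverse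
`g^{ij} + ε h^{ij}`. Where `g` is non-singular, the last term is `g` itself; it is written in
this way so that the field is unchanged at every point at which `ε h` vanishes. -/
def vary (G h : Field2) (ε : ℝ) : Field2 := fun x =>
  G x + (((symPart G x)⁻¹ + ε • h x)⁻¹ - ((symPart G x)⁻¹)⁻¹)

/-- The connection coefficients depend smoothly on the point and on the parameter of every
variation of the metric. -/
def IsSmoothConnectionLaw (U : Set Point) (G : Field2) (conn : Field2 → Field3) : Prop :=
  ∀ h, IsVariation U h → ∃ δ > 0, ∀ i j k,
    ContDiffOn ℝ ∞ (fun q : ℝ × Point => conn (vary G h q.1) q.2 i j k)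
      (Set.Ioo (-δ) δ ×ˢ U)

/-- `A_{ij} B^{ij}`. -/
def pairing (A B : Matrix (Fin 4) (Fin 4) ℝ) : ℝ := ∑ i, ∑ j, A i j * B i j

/-- Continuous symmetric tensor fields of type `(0,2)` on `U`. -/
structure IsSymmField (U : Set Point) (A : Field2) : Prop where
  cont : ∀ i j, ContinuousOn (fun x => A x i j) U
  symm : ∀ x ∈ U, (A x).IsSymm

/-- `V_{ij} = δL/δg^{ij}`: `∫ √|g| δL = ∫ √|g| V_{ij} δg^{ij}` for all variations, where `δL` is
the derivative of the scalar field `L` along the variation. -/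
structure IsVariationalDerivative (U : Set Point) (G : Field2) (L : Lagrangian) (V : Field2) :
    Prop where
  field : IsSymmField U V
  variation : ∀ h, IsVariation U h → ∀ K, IsCompact K → tsupport h ⊆ K → K ⊆ U →
    ∫ x in K, volDensity (symPart G) x * deriv (fun ε => L (vary G h ε) x) 0
      = ∫ x in K, volDensity (symPart G) x * pairing (V x) (h x)

/-- The action `∫ √|g| (R - 2Λ + L)` over the region `K`. -/
def action (Λ : ℝ) (L : Lagrangian) (K : Set Point) (G : Field2) : ℝ :=
  ∫ x in K, volDensity (symPart G) x * (scalarCurv (symPart G) x - 2 * Λ + L G x)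

/-- The action is stationary at `G` under all variations of `g^{ij}`. -/
def IsStationary (U : Set Point) (Λ : ℝ) (L : Lagrangian) (G : Field2) : Prop :=
  ∀ h, IsVariation U h → ∀ K, IsCompact K → tsupport h ⊆ K → K ⊆ U →
    HasDerivAt (fun ε => action Λ L K (vary G h ε)) 0 0

/-- `T_{ij}` is the energy-momentum tensor of the matter Lagrangian `L`:
`δ ∫ √|g| L = - ∫ √|g| T_{ij} δg^{ij}`. With this normalization the equations of motion of the
action `∫ √|g| (R - 2Λ + L)` are `R_{ij} - R g_{ij} / 2 + Λ g_{ij} = T_{ij}`. -/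
structure IsEnergyMomentum (U : Set Point) (G : Field2) (L : Lagrangian) (T : Field2) :
    Prop where
  field : IsSymmField U T
  variation : ∀ h, IsVariation U h → ∀ K, IsCompact K → tsupport h ⊆ K → K ⊆ U →
    HasDerivAt (fun ε => ∫ x in K, volDensity (symPart (vary G h ε)) x * L (vary G h ε) x)
      (-∫ x in K, volDensity (symPart G) x * pairing (T x) (h x)) 0

/-! ### Traces, energy-density, pressure and state parameter at a point

Here `g` and `T` are the matrices of components at the point, and `u` is a vector `u^i`. -/

/-- The trace `A^i_i = g^{ij} A_{ij}`. -/
def traceWith (g A : Matrix (Fin 4) (Fin 4) ℝ) : ℝ := pairing A g⁻¹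

/-- `A_{ij} u^i u^j`. -/
def quad (A : Matrix (Fin 4) (Fin 4) ℝ) (u : Fin 4 → ℝ) : ℝ := ∑ i, ∑ j, A i j * u i * u j

/-- The projector `h^k_i = δ^k_i - u_i u^k`. -/
def projector (g : Matrix (Fin 4) (Fin 4) ℝ) (u : Fin 4 → ℝ) (k i : Fin 4) : ℝ :=
  (if k = i then 1 else 0) - (∑ a, g i a * u a) * u k

/-- `Π_{ij} = - T_{ab} h^a_i h^b_j`. -/
def stress (g T : Matrix (Fin 4) (Fin 4) ℝ) (u : Fin 4 → ℝ) : Matrix (Fin 4) (Fin 4) ℝ :=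
  Matrix.of fun i j => -∑ a, ∑ b, T a b * projector g u a i * projector g u b j

/-- The pressure `p = Π^i_i / 3` in the frame `u`. -/
def pressure (g T : Matrix (Fin 4) (Fin 4) ℝ) (u : Fin 4 → ℝ) : ℝ :=
  (1 / 3) * traceWith g (stress g T u)

/-- The energy-density `ρ = T_{ij} u^i u^j` in the frame `u`. -/
def energyDensity (T : Matrix (Fin 4) (Fin 4) ℝ) (u : Fin 4 → ℝ) : ℝ := quad T u

/-- The state parameter `ω = p / ρ`. -/
def stateParameter (g T : Matrix (Fin 4) (Fin 4) ℝ) (u : Fin 4 → ℝ) : ℝ :=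
  pressure g T u / energyDensity T u

/-- The comoving frame `u^i = δ^i_0`. -/
def comoving : Fin 4 → ℝ := Pi.single 0 1

/-- The Ricci curvature at a point as a matrix. -/
def ricciAt (g : Field2) (x : Point) : Matrix (Fin 4) (Fin 4) ℝ :=
  Matrix.of fun i j => ricci g x i j

/-- The equations of motion at the point `x`:
`R_{ij} - R g_{ij} / 2 + Λ g_{ij} = - V_{ij} + g_{ij} L / 2`. -/
def EinsteinEq (Λ : ℝ) (g V : Field2) (ell : Point → ℝ) (x : Point) : Prop :=
  ∀ i j, ricci g x i j - (1 / 2) * scalarCurv g x * g x i j + Λ * g x i j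
    = -V x i j + (1 / 2) * g x i j * ell x

end GenRiem

end

open GenRiem

/-! The proof is the Hilbert variational argument, made rigorous along the explicit family of
metrics whose inverse symmetric part is `g⁻¹ + ε h`. A tube argument over the compact support of `h`
gives one interval of `ε` on which all these metrics are non-singular on `U`
(`exists_det_inv_add_ne_zero`). On it every geometric quantity is jointly smooth in `(ε, x)`, so
partial derivatives commute with `d/dε` and integrals over compact sets may be differentiated under
the integral sign.

Three variations make up the derivative of the action. Jacobi's formula gives `δ√|g| = -½ √|g|
g_{ij} h^{ij}` (`hasDerivAt_volDensity_vary`). The Palatini identity (`sum_invDensity_mul_dt_ricci`)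
turns `√|g| g^{ij} δR_{ij}` into a coordinate divergence, because `√|g| g^{ij}` is covariantly
constant; its current vanishes off the support of `h`, so it integrates to zero. The variation of
the matter Lagrangian is known only under the integral, where it is replaced by `V_{ij} h^{ij}`.
Hence the derivative is the integral of `√|g|` times the pairing of `R_{ij} - ½ R g_{ij} + Λ g_{ij}
- T_{ij}` with `h`, where `T = -V + ½ L g` (`hasDerivAt_action`).

The fundamental lemma for symmetric fields then gives the equations of motion. It applies because
this gradient is continuous and symmetric; the symmetry of the Ricci tensor uses that the contracted
Christoffel symbols form a gradient. The same lemma makes the energy-momentum tensor unique, so any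
such tensor is the explicit one. The rest is linear algebra at a point: projecting the inverse
metric off a unit vector gives `p = (ρ - tr T) / 3`, and tracing and contracting the field equations
gives the equilibrium equations. -/

noncomputable section

namespace GenRiem

/-! ### Directional derivatives of matrix-valued functions -/

section MatrixCalculus

variable {E : Type*} [NormedAddCommGroup E] [NormedSpace ℝ E] {n : Type*} [Fintype n]
  [DecidableEq n]

/-- The matrix of directional derivatives of the entries. -/
def dirMat (A : E → Matrix n n ℝ) (x v : E) : Matrix n n ℝ :=
  Matrix.of fun i j => fderiv ℝ (fun y => A y i j) x v

theorem differentiableAt_det {A : E → Matrix n n ℝ} {x : E}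
    (hA : ∀ i j, DifferentiableAt ℝ (fun y => A y i j) x) :
    DifferentiableAt ℝ (fun y => (A y).det) x := by
  simp only [Matrix.det_apply]
  fun_prop

theorem contDiffAt_det {A : E → Matrix n n ℝ} {x : E} {m : WithTop ℕ∞}
    (hA : ∀ i j, ContDiffAt ℝ m (fun y => A y i j) x) :
    ContDiffAt ℝ m (fun y => (A y).det) x := by
  simp only [Matrix.det_apply]
  refine ContDiffAt.sum fun σ _ => ContDiffAt.const_smul _ (contDiffAt_prod fun i _ => hA _ _)

/-- Cramer's rule: each entry is a quotient of two determinants, hence of polynomials in the entries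
of `A`. -/
theorem contDiffAt_inv_apply {A : E → Matrix n n ℝ} {x : E} {m : WithTop ℕ∞}
    (hA : ∀ i j, ContDiffAt ℝ m (fun y => A y i j) x) (hx : (A x).det ≠ 0) (i j : n) :
    ContDiffAt ℝ m (fun y => (A y)⁻¹ i j) x := by
  have h : (fun y => (A y)⁻¹ i j) =
      fun y => ((A y).det)⁻¹ * ((A y).updateRow j (Pi.single i 1)).det := by
    funext y
    simp [Matrix.inv_def, Matrix.adjugate_apply]
  rw [h]
  refine ((contDiffAt_det hA).inv hx).mul (contDiffAt_det fun k l => ?_)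
  by_cases hk : k = j
  · subst hk
    simpa using contDiffAt_const
  · simpa [Matrix.updateRow_ne hk] using hA k l

/-- Jacobi's formula. In the differentiated Leibniz expansion, the terms where column `i` is
differentiated form the determinant with that column replaced. Cramer's rule reads this as a
diagonal entry of the adjugate times the derivative, and the adjugate is `det A • A⁻¹`. -/
theorem fderiv_det {A : E → Matrix n n ℝ} {x v : E}
    (hA : ∀ i j, DifferentiableAt ℝ (fun y => A y i j) x) (hx : (A x).det ≠ 0) :
    fderiv ℝ (fun y => (A y).det) x v = (A x).det * ((A x)⁻¹ * dirMat A x v).trace := by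
  have h1 : HasFDerivAt (fun y => (A y).det)
      (∑ σ : Equiv.Perm n, Equiv.Perm.sign σ • ∑ i, (∏ j ∈ Finset.univ.erase i, A x (σ j) j) •
        fderiv ℝ (fun y => A y (σ i) i) x) x := by
    simp only [Matrix.det_apply]
    exact HasFDerivAt.fun_sum fun σ _ => (HasFDerivAt.finsetProd
      (fun i _ => (hA (σ i) i).hasFDerivAt)).const_smul _
  have h2 : ∀ i, ∑ σ : Equiv.Perm n, Equiv.Perm.sign σ •
      ((∏ j ∈ Finset.univ.erase i, A x (σ j) j) * dirMat A x v (σ i) i)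
      = ((A x).updateCol i (fun k => dirMat A x v k i)).det := by
    intro i
    rw [Matrix.det_apply]
    refine Finset.sum_congr rfl fun σ _ => ?_
    congr 1
    rw [← Finset.mul_prod_erase _ _ (Finset.mem_univ i), mul_comm]
    congr 1
    · simp
    · refine Finset.prod_congr rfl fun j hj => ?_
      rw [Matrix.updateCol_ne (Finset.ne_of_mem_erase hj)]
  have h3 : (A x).det • (A x)⁻¹ = (A x).adjugate := by
    rw [Matrix.inv_def, smul_smul, Ring.mul_inverse_cancel _ (isUnit_iff_ne_zero.2 hx), one_smul]
  rw [h1.fderiv, ← smul_eq_mul, ← Matrix.trace_smul, ← Matrix.smul_mul, h3]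
  simp only [FunLike.coe_sum, Finset.sum_apply, FunLike.coe_smul,
    Pi.smul_apply, smul_eq_mul, Finset.smul_sum]
  rw [Finset.sum_comm]
  refine Finset.sum_congr rfl fun i _ => ?_
  rw [Matrix.diag_apply, Matrix.mul_apply]
  trans ((A x).updateCol i (fun k => dirMat A x v k i)).det
  · exact h2 i
  · rw [← Matrix.cramer_apply, Matrix.cramer_eq_adjugate_mulVec]
    rfl

omit [DecidableEq n] in
theorem dirMat_mul {A B : E → Matrix n n ℝ} {x v : E}
    (hA : ∀ i j, DifferentiableAt ℝ (fun y => A y i j) x)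
    (hB : ∀ i j, DifferentiableAt ℝ (fun y => B y i j) x) :
    dirMat (fun y => A y * B y) x v = dirMat A x v * B x + A x * dirMat B x v := by
  ext i j
  simp only [dirMat, Matrix.of_apply, Matrix.add_apply, Matrix.mul_apply]
  rw [fderiv_fun_sum fun k _ => (hA i k).fun_mul (hB k j), sum_apply,
    ← Finset.sum_add_distrib]
  refine Finset.sum_congr rfl fun k _ => ?_
  rw [fderiv_fun_mul (hA i k) (hB k j)]
  simp
  ring

/-- Differentiate `A⁻¹ A = 1`, which persists near `x` because non-vanishing of the determinant is
an open condition. -/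
theorem dirMat_inv {A : E → Matrix n n ℝ} {x v : E}
    (hA : ∀ i j, ContDiffAt ℝ 1 (fun y => A y i j) x) (hx : (A x).det ≠ 0) :
    dirMat (fun y => (A y)⁻¹) x v = -((A x)⁻¹ * dirMat A x v * (A x)⁻¹) := by
  have hd : ∀ i j, DifferentiableAt ℝ (fun y => A y i j) x :=
    fun i j => (hA i j).differentiableAt one_ne_zero
  have hi : ∀ i j, DifferentiableAt ℝ (fun y => (A y)⁻¹ i j) x :=
    fun i j => (contDiffAt_inv_apply hA hx i j).differentiableAt one_ne_zero
  have hev : ∀ᶠ y in nhds x, (A y).det ≠ 0 :=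
    (differentiableAt_det hd).continuousAt.eventually_ne hx
  have h0 : dirMat (fun y => (A y)⁻¹ * A y) x v = 0 := by
    ext i j
    simp only [dirMat, Matrix.of_apply, Matrix.zero_apply]
    have : (fun y => ((A y)⁻¹ * A y) i j) =ᶠ[nhds x] fun _ => (1 : Matrix n n ℝ) i j := by
      filter_upwards [hev] with y hy
      rw [Matrix.nonsing_inv_mul _ (isUnit_iff_ne_zero.2 hy)]
    rw [this.fderiv_eq]
    simp
  rw [dirMat_mul hi hd] at h0
  have h1 := congrArg (· * (A x)⁻¹) h0
  simp only [Matrix.add_mul, Matrix.mul_assoc, Matrix.zero_mul,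
    Matrix.mul_nonsing_inv _ (isUnit_iff_ne_zero.2 hx), Matrix.mul_one] at h1
  rw [Matrix.mul_assoc]
  exact eq_neg_of_add_eq_zero_left h1

theorem fderiv_sqrt_abs {f : E → ℝ} {x v : E} (hf : DifferentiableAt ℝ f x) (hx : f x ≠ 0) :
    fderiv ℝ (fun y => Real.sqrt |f y|) x v
      = (1 / 2) * Real.sqrt |f x| * ((f x)⁻¹ * fderiv ℝ f x v) := by
  have habs : |f x| ≠ 0 := abs_ne_zero.2 hx
  have h := ((hasDerivAt_abs hx).comp_hasFDerivAt x hf.hasFDerivAt).sqrt habs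
  have h' : fderiv ℝ (fun y => Real.sqrt |f y|) x = _ := h.fderiv
  rw [h']
  have hs : Real.sqrt |f x| * Real.sqrt |f x| = |f x| := Real.mul_self_sqrt (abs_nonneg _)
  have hs0 : Real.sqrt |f x| ≠ 0 := (Real.sqrt_pos.2 (abs_pos.2 hx)).ne'
  -- This identity treats both signs of the determinant at once, so the signature of the metric
  -- never matters.
  have hsg : (SignType.sign (f x) : ℝ) * f x = |f x| := by
    rw [mul_comm]; exact self_mul_sign (f x)
  simp only [FunLike.coe_smul, Pi.smul_apply, smul_eq_mul, Function.comp]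
  field_simp
  rw [pow_two, hs, ← hsg]
  ring

theorem contDiffAt_sqrt_abs {f : E → ℝ} {x : E} {m : ℕ∞} (hf : ContDiffAt ℝ m f x)
    (hx : f x ≠ 0) : ContDiffAt ℝ m (fun y => Real.sqrt |f y|) x :=
  ((contDiffAt_abs hx).comp x hf).sqrt (abs_ne_zero.2 hx)

end MatrixCalculus

section

/-! ### Smooth one-parameter families of scalar fields -/

/-- The family `F ε x` is smooth in `(ε, x)` for `|ε| < δ` and `x ∈ U`. -/
def SmoothFam (δ : ℝ) (U : Set Point) (F : ℝ → Point → ℝ) : Prop :=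
  ContDiffOn ℝ ∞ (fun q : ℝ × Point => F q.1 q.2) (Set.Ioo (-δ) δ ×ˢ U)

/-- The derivative of a family with respect to its parameter. -/
def dt (F : ℝ → Point → ℝ) (e : ℝ) (x : Point) : ℝ := deriv (fun s => F s x) e

variable {δ : ℝ} {U : Set Point} {F H : ℝ → Point → ℝ} {e : ℝ} {x : Point}

theorem prod_mem_nhds_of_isOpen (hU : IsOpen U) (he : e ∈ Set.Ioo (-δ) δ) (hx : x ∈ U) :
    Set.Ioo (-δ) δ ×ˢ U ∈ nhds (e, x) :=
  (isOpen_Ioo.prod hU).mem_nhds ⟨he, hx⟩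

namespace SmoothFam

theorem contDiffAt (hF : SmoothFam δ U F) (hU : IsOpen U) (he : e ∈ Set.Ioo (-δ) δ)
    (hx : x ∈ U) : ContDiffAt ℝ ∞ (fun q : ℝ × Point => F q.1 q.2) (e, x) :=
  ContDiffOn.contDiffAt hF (prod_mem_nhds_of_isOpen hU he hx)

theorem of_contDiffAt (h : ∀ e ∈ Set.Ioo (-δ) δ, ∀ x ∈ U,
    ContDiffAt ℝ ∞ (fun q : ℝ × Point => F q.1 q.2) (e, x)) : SmoothFam δ U F :=
  fun q hq => (h q.1 hq.1 q.2 hq.2).contDiffWithinAt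

theorem congr (hF : SmoothFam δ U F) (h : ∀ e ∈ Set.Ioo (-δ) δ, ∀ x ∈ U, H e x = F e x) :
    SmoothFam δ U H :=
  ContDiffOn.congr hF fun q hq => h q.1 hq.1 q.2 hq.2

theorem mono {δ' : ℝ} (hF : SmoothFam δ U F) (h : δ' ≤ δ) : SmoothFam δ' U F :=
  ContDiffOn.mono hF (Set.prod_mono (Set.Ioo_subset_Ioo (neg_le_neg h) h) le_rfl)

theorem const {f : Point → ℝ} (hf : ContDiffOn ℝ ∞ f U) : SmoothFam δ U (fun _ => f) :=
  hf.comp contDiff_snd.contDiffOn fun _ hq => hq.2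

theorem add (hF : SmoothFam δ U F) (hH : SmoothFam δ U H) :
    SmoothFam δ U (fun e x => F e x + H e x) := ContDiffOn.add hF hH

theorem sub (hF : SmoothFam δ U F) (hH : SmoothFam δ U H) :
    SmoothFam δ U (fun e x => F e x - H e x) := ContDiffOn.sub hF hH

theorem mul (hF : SmoothFam δ U F) (hH : SmoothFam δ U H) :
    SmoothFam δ U (fun e x => F e x * H e x) := ContDiffOn.mul hF hH

theorem const_mul (c : ℝ) (hF : SmoothFam δ U F) : SmoothFam δ U (fun e x => c * F e x) :=
  contDiffOn_const.mul hF

theorem sum {ι : Type*} {s : Finset ι} {F : ι → ℝ → Point → ℝ}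
    (hF : ∀ i, SmoothFam δ U (F i)) : SmoothFam δ U (fun e x => ∑ i ∈ s, F i e x) :=
  ContDiffOn.sum fun i _ => hF i

theorem differentiableAt (hF : SmoothFam δ U F) (hU : IsOpen U) (he : e ∈ Set.Ioo (-δ) δ)
    (hx : x ∈ U) : DifferentiableAt ℝ (fun q : ℝ × Point => F q.1 q.2) (e, x) :=
  (hF.contDiffAt hU he hx).differentiableAt (by simp)

theorem contDiffAt_space (hF : SmoothFam δ U F) (hU : IsOpen U) (he : e ∈ Set.Ioo (-δ) δ)
    (hx : x ∈ U) : ContDiffAt ℝ ∞ (F e) x :=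
  (hF.contDiffAt hU he hx).comp x (contDiffAt_const.prodMk contDiffAt_id)

theorem contDiffAt_param (hF : SmoothFam δ U F) (hU : IsOpen U) (he : e ∈ Set.Ioo (-δ) δ)
    (hx : x ∈ U) : ContDiffAt ℝ ∞ (fun s => F s x) e :=
  ContDiffAt.comp (g := fun q : ℝ × Point => F q.1 q.2) (f := fun s => (s, x)) e
    (hF.contDiffAt hU he hx) (contDiffAt_id.prodMk contDiffAt_const)

theorem differentiableAt_space (hF : SmoothFam δ U F) (hU : IsOpen U)
    (he : e ∈ Set.Ioo (-δ) δ) (hx : x ∈ U) : DifferentiableAt ℝ (F e) x :=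
  (hF.contDiffAt_space hU he hx).differentiableAt (by simp)

theorem differentiableAt_param (hF : SmoothFam δ U F) (hU : IsOpen U)
    (he : e ∈ Set.Ioo (-δ) δ) (hx : x ∈ U) : DifferentiableAt ℝ (fun s => F s x) e :=
  (hF.contDiffAt_param hU he hx).differentiableAt (by simp)

theorem continuousOn (hF : SmoothFam δ U F) (he : e ∈ Set.Ioo (-δ) δ) :
    ContinuousOn (F e) U :=
  (ContDiffOn.continuousOn hF).comp (f := fun x => (e, x)) (by fun_prop) fun _ hx => ⟨he, hx⟩

/-- Together with `dt_eq`, this expresses space and parameter derivatives as directional derivatives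
of one function on the product, so that interchanging them becomes symmetry of a single second
derivative. -/
theorem pd_eq (hF : SmoothFam δ U F) (hU : IsOpen U) (he : e ∈ Set.Ioo (-δ) δ) (hx : x ∈ U)
    (k : Fin 4) :
    GenRiem.pd k (F e) x
      = fderiv ℝ (fun q : ℝ × Point => F q.1 q.2) (e, x) (0, Pi.single k 1) := by
  have h := (hF.differentiableAt hU he hx).hasFDerivAt.comp x
    ((hasFDerivAt_const e x).prodMk (hasFDerivAt_id x))
  have h' : fderiv ℝ (F e) x = _ := h.fderiv
  rw [GenRiem.pd, h']
  simp

theorem dt_eq (hF : SmoothFam δ U F) (hU : IsOpen U) (he : e ∈ Set.Ioo (-δ) δ) (hx : x ∈ U) :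
    GenRiem.dt F e x = fderiv ℝ (fun q : ℝ × Point => F q.1 q.2) (e, x) (1, 0) := by
  have h := HasFDerivAt.comp (g := fun q : ℝ × Point => F q.1 q.2) (f := fun s => (s, x)) e
    (hF.differentiableAt hU he hx).hasFDerivAt ((hasFDerivAt_id e).prodMk (hasFDerivAt_const x e))
  have h' : fderiv ℝ (fun s => F s x) e = _ := h.fderiv
  rw [GenRiem.dt, ← fderiv_apply_one_eq_deriv, h']
  simp

theorem fderiv_apply (hF : SmoothFam δ U F) (hU : IsOpen U) (v : ℝ × Point) :
    SmoothFam δ U (fun e x => fderiv ℝ (fun q : ℝ × Point => F q.1 q.2) (e, x) v) := by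
  have h := ContDiffOn.fderiv_of_isOpen (m := ∞) hF (isOpen_Ioo.prod hU) (by simp)
  exact h.clm_apply contDiffOn_const

theorem pd (hF : SmoothFam δ U F) (hU : IsOpen U) (k : Fin 4) :
    SmoothFam δ U (fun e x => GenRiem.pd k (F e) x) :=
  (hF.fderiv_apply hU _).congr fun _ he _ hx => hF.pd_eq hU he hx k

theorem dt (hF : SmoothFam δ U F) (hU : IsOpen U) : SmoothFam δ U (GenRiem.dt F) :=
  (hF.fderiv_apply hU _).congr fun _ he _ hx => hF.dt_eq hU he hx

theorem fderiv_fderiv_apply (hF : SmoothFam δ U F) (hU : IsOpen U) (he : e ∈ Set.Ioo (-δ) δ)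
    (hx : x ∈ U) (v w : ℝ × Point) :
    fderiv ℝ (fun p : ℝ × Point => fderiv ℝ (fun q : ℝ × Point => F q.1 q.2) (p.1, p.2) v)
      (e, x) w
      = fderiv ℝ (fderiv ℝ (fun q : ℝ × Point => F q.1 q.2)) (e, x) w v := by
  have hd : DifferentiableAt ℝ (fderiv ℝ (fun q : ℝ × Point => F q.1 q.2)) (e, x) :=
    ((hF.contDiffAt hU he hx).fderiv_right (m := 1) 
      (WithTop.coe_le_coe.2 (le_top : (1 + 1 : ℕ∞) ≤ ⊤))).differentiableAt one_ne_zero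
  have h := hd.hasFDerivAt.clm_apply (hasFDerivAt_const v (e, x))
  have h' : fderiv ℝ (fun p : ℝ × Point =>
    fderiv ℝ (fun q : ℝ × Point => F q.1 q.2) (p.1, p.2) v) (e, x) = _ := h.fderiv
  rw [h']
  simp

theorem isSymmSndFDerivAt (hF : SmoothFam δ U F) (hU : IsOpen U) (he : e ∈ Set.Ioo (-δ) δ)
    (hx : x ∈ U) : IsSymmSndFDerivAt ℝ (fun q : ℝ × Point => F q.1 q.2) (e, x) :=
  (hF.contDiffAt hU he hx).isSymmSndFDerivAt (by
    rw [minSmoothness_of_isRCLikeNormedField]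
    exact WithTop.coe_le_coe.2 (le_top : (2 : ℕ∞) ≤ ⊤))

theorem fderiv_congr (h : ∀ e ∈ Set.Ioo (-δ) δ, ∀ x ∈ U, H e x = F e x) (hU : IsOpen U)
    (he : e ∈ Set.Ioo (-δ) δ) (hx : x ∈ U) :
    fderiv ℝ (fun q : ℝ × Point => H q.1 q.2) (e, x)
      = fderiv ℝ (fun q : ℝ × Point => F q.1 q.2) (e, x) := by
  refine Filter.EventuallyEq.fderiv_eq ?_
  filter_upwards [prod_mem_nhds_of_isOpen hU he hx] with q hq
  exact h q.1 hq.1 q.2 hq.2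

theorem dt_pd (hF : SmoothFam δ U F) (hU : IsOpen U) (he : e ∈ Set.Ioo (-δ) δ) (hx : x ∈ U)
    (k : Fin 4) :
    GenRiem.dt (fun s y => GenRiem.pd k (F s) y) e x = GenRiem.pd k (GenRiem.dt F e) x := by
  rw [(hF.pd hU k).dt_eq hU he hx, (hF.dt hU).pd_eq hU he hx,
    fderiv_congr (fun s hs y hy => hF.pd_eq hU hs hy k) hU he hx,
    fderiv_congr (fun s hs y hy => hF.dt_eq hU hs hy) hU he hx,
    hF.fderiv_fderiv_apply hU he hx, hF.fderiv_fderiv_apply hU he hx]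
  exact hF.isSymmSndFDerivAt hU he hx _ _

theorem pd_pd (hF : SmoothFam δ U F) (hU : IsOpen U) (he : e ∈ Set.Ioo (-δ) δ) (hx : x ∈ U)
    (k l : Fin 4) :
    GenRiem.pd k (fun y => GenRiem.pd l (F e) y) x
      = GenRiem.pd l (fun y => GenRiem.pd k (F e) y) x := by
  rw [(hF.pd hU l).pd_eq hU he hx, (hF.pd hU k).pd_eq hU he hx,
    fderiv_congr (fun s hs y hy => hF.pd_eq hU hs hy k) hU he hx,
    fderiv_congr (fun s hs y hy => hF.pd_eq hU hs hy l) hU he hx,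
    hF.fderiv_fderiv_apply hU he hx, hF.fderiv_fderiv_apply hU he hx]
  exact hF.isSymmSndFDerivAt hU he hx _ _

end SmoothFam

/-! ### Smooth families of metrics -/

/-- A family of symmetric metrics, smooth and non-singular for `|ε| < δ` and `x ∈ U`. -/
structure SmoothMetricFam (δ : ℝ) (U : Set Point) (γ : ℝ → Field2) : Prop where
  smooth : ∀ i j, SmoothFam δ U (fun e x => γ e x i j)
  symm : ∀ e x, (γ e x).IsSymm
  det_ne_zero : ∀ e ∈ Set.Ioo (-δ) δ, ∀ x ∈ U, (γ e x).det ≠ 0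

/-- A family of arrays whose components are smooth families. -/
def SmoothFam3 (δ : ℝ) (U : Set Point) (A : ℝ → Field3) : Prop :=
  ∀ i j k, SmoothFam δ U (fun e x => A e x i j k)

variable {γ : ℝ → Field2} {A : ℝ → Field3}

namespace SmoothMetricFam

theorem inv (hγ : SmoothMetricFam δ U γ) (hU : IsOpen U) (i j : Fin 4) :
    SmoothFam δ U (fun e x => (γ e x)⁻¹ i j) :=
  .of_contDiffAt fun _ he _ hx =>
    contDiffAt_inv_apply (A := fun q : ℝ × Point => γ q.1 q.2)
      (fun i j => (hγ.smooth i j).contDiffAt hU he hx) (hγ.det_ne_zero _ he _ hx) i j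

theorem volDensity (hγ : SmoothMetricFam δ U γ) (hU : IsOpen U) :
    SmoothFam δ U (fun e x => GenRiem.volDensity (γ e) x) :=
  .of_contDiffAt fun _ he _ hx =>
    contDiffAt_sqrt_abs (f := fun q : ℝ × Point => (γ q.1 q.2).det)
      (contDiffAt_det (A := fun q : ℝ × Point => γ q.1 q.2)
        fun i j => (hγ.smooth i j).contDiffAt hU he hx)
      (hγ.det_ne_zero _ he _ hx)

theorem christoffel (hγ : SmoothMetricFam δ U γ) (hU : IsOpen U) :
    SmoothFam3 δ U (fun e => GenRiem.christoffel (γ e)) := fun i j k =>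
  .const_mul _ <| .sum fun a => (hγ.inv hU i a).mul <|
    (((hγ.smooth j a).pd hU k).sub ((hγ.smooth j k).pd hU a)).add ((hγ.smooth a k).pd hU j)

theorem ricci (hγ : SmoothMetricFam δ U γ) (hU : IsOpen U) (i j : Fin 4) :
    SmoothFam δ U (fun e x => GenRiem.ricci (γ e) x i j) :=
  have hC := hγ.christoffel hU
  .sum fun c => (((hC c i j).pd hU c).sub ((hC c i c).pd hU j)).add
    (.sum fun a => (hC a i j).mul (hC c a c)) |>.sub (.sum fun a => (hC a i c).mul (hC c a j))

theorem scalarCurv (hγ : SmoothMetricFam δ U γ) (hU : IsOpen U) :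
    SmoothFam δ U (fun e x => GenRiem.scalarCurv (γ e) x) :=
  .sum fun i => .sum fun j => (hγ.inv hU i j).mul (hγ.ricci hU i j)

theorem covDeriv (hγ : SmoothMetricFam δ U γ) (hA : SmoothFam3 δ U A) (hU : IsOpen U)
    (i j k n : Fin 4) : SmoothFam δ U (fun e x => GenRiem.covDeriv (γ e) (A e) x i j k n) :=
  have hC := hγ.christoffel hU
  ((((hA i j k).pd hU n).add (.sum fun a => (hC i a n).mul (hA a j k))).sub
    (.sum fun a => (hC a j n).mul (hA i a k))).sub (.sum fun a => (hC a k n).mul (hA i j a))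

theorem _root_.GenRiem.SmoothFam3.torsion (hA : SmoothFam3 δ U A) :
    SmoothFam3 δ U (fun e => GenRiem.torsion (A e)) :=
  fun i j k => (hA i j k).sub (hA i k j)

theorem torsionLow (hγ : SmoothMetricFam δ U γ) (hA : SmoothFam3 δ U A) :
    SmoothFam3 δ U (fun e => GenRiem.torsionLow (γ e) (A e)) :=
  fun i j k => .sum fun a => (hγ.smooth i a).mul (hA.torsion a j k)

theorem nonmetricity (hγ : SmoothMetricFam δ U γ) (hA : SmoothFam3 δ U A) (hU : IsOpen U) :
    SmoothFam3 δ U (fun e => GenRiem.nonmetricity (γ e) (A e)) :=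
  fun i j k => (((hγ.smooth i j).pd hU k).sub
    (.sum fun a => (hA a i k).mul (hγ.smooth a j))).sub
      (.sum fun a => (hA a j k).mul (hγ.smooth i a))

theorem etaLow (hγ : SmoothMetricFam δ U γ) (hA : SmoothFam3 δ U A) (hU : IsOpen U) :
    SmoothFam3 δ U (fun e => GenRiem.etaLow (γ e) (A e)) :=
  have hT := hγ.torsionLow hA
  have hN := hγ.nonmetricity hA hU
  fun a j k => ((((hT j a k).add (hT k a j)).add (hN k a j)).add (hN a j k)).sub (hN k j a)

theorem eta (hγ : SmoothMetricFam δ U γ) (hA : SmoothFam3 δ U A) (hU : IsOpen U) :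
    SmoothFam3 δ U (fun e => GenRiem.eta (γ e) (A e)) :=
  fun i j k => .sum fun a => (hγ.inv hU i a).mul (hγ.etaLow hA hU a j k)

theorem matterScalar (hγ : SmoothMetricFam δ U γ) (hA : SmoothFam3 δ U A) (hU : IsOpen U)
    (u v w : ℝ) : SmoothFam δ U (fun e x => GenRiem.matterScalar u v w (γ e) (A e) x) :=
  have hi := hγ.inv hU
  have hE := hγ.eta hA hU
  have hT := hA.torsion
  have h1 := SmoothFam.const_mul (-(1 / 2)) <| .sum (s := Finset.univ) fun b =>
    .sum (s := Finset.univ) fun c =>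
    (hi b c).mul (.sum (s := Finset.univ) fun a => hγ.covDeriv hE hU a b c a)
  have h2 := SmoothFam.const_mul (1 / 2) <| .sum (s := Finset.univ) fun b =>
    .sum (s := Finset.univ) fun c =>
    (hi b c).mul (.sum (s := Finset.univ) fun a => hγ.covDeriv hE hU a a b c)
  have h3 := SmoothFam.const_mul (1 / 4) <| .sum (s := Finset.univ) fun c =>
    .sum (s := Finset.univ) fun d =>
    (hi c d).mul (.sum (s := Finset.univ) fun a => .sum (s := Finset.univ) fun b =>
      ((hE a c d).mul (hE b a b)).sub ((hE a b c).mul (hE b a d)))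
  have h4 := SmoothFam.const_mul (v + w) <| .sum (s := Finset.univ) fun c =>
    .sum (s := Finset.univ) fun d =>
    (hi c d).mul (.sum (s := Finset.univ) fun a => .sum (s := Finset.univ) fun b =>
      (hT a c b).mul (hT b d a))
  have h5 := SmoothFam.const_mul u <| .sum (s := Finset.univ) fun b =>
    .sum (s := Finset.univ) fun c =>
    (hi b c).mul (.sum (s := Finset.univ) fun a => hγ.covDeriv hT hU a b a c)
  have h6 := SmoothFam.const_mul (u / 2) <| .sum (s := Finset.univ) fun a =>
    .sum (s := Finset.univ) fun b => .sum (s := Finset.univ) fun d =>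
    .sum (s := Finset.univ) fun e =>
    (((hi a b).mul (hi d e)).mul (hγ.etaLow hA hU a d e)).mul
      (.sum (s := Finset.univ) fun c => hT c b c)
  ((((h1.add h2).add h3).sub h4).add h5).add h6

end SmoothMetricFam

end

section

variable {δ : ℝ} {U : Set Point} {F H : ℝ → Point → ℝ} {e : ℝ} {x : Point} {γ : ℝ → Field2}

/-! ### Calculus of partial derivatives -/

section Pd

variable {f f' : Point → ℝ} {k : Fin 4}

theorem pd_mul (hf : DifferentiableAt ℝ f x) (hf' : DifferentiableAt ℝ f' x) :
    pd k (fun y => f y * f' y) x = pd k f x * f' x + f x * pd k f' x := by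
  simp only [pd]
  rw [fderiv_fun_mul hf hf']
  simp
  ring

theorem pd_sub (hf : DifferentiableAt ℝ f x) (hf' : DifferentiableAt ℝ f' x) :
    pd k (fun y => f y - f' y) x = pd k f x - pd k f' x := by
  simp only [pd]
  rw [fderiv_fun_sub hf hf']
  simp

theorem pd_sum {ι : Type*} {s : Finset ι} {f : ι → Point → ℝ}
    (hf : ∀ i ∈ s, DifferentiableAt ℝ (f i) x) :
    pd k (fun y => ∑ i ∈ s, f i y) x = ∑ i ∈ s, pd k (f i) x := by
  simp only [pd]
  rw [fderiv_fun_sum hf]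
  simp

theorem pd_congr (h : f =ᶠ[nhds x] f') : pd k f x = pd k f' x := by
  rw [pd, pd, h.fderiv_eq]

end Pd

/-! ### Christoffel symbols: symmetry and compatibility with the metric -/

theorem christoffel_symm {g : Field2} (hg : ∀ y, (g y).IsSymm) (x : Point) (i j k : Fin 4) :
    christoffel g x i j k = christoffel g x i k j := by
  have h : ∀ a b, (fun y => g y a b) = fun y => g y b a := fun a b => funext fun y => (hg y).apply b a
  simp only [christoffel]
  congr 1
  refine Finset.sum_congr rfl fun a _ => ?_
  rw [h a k, h a j, h k j]
  ring

/-- The matrix `(Γ_k)^i_j = Γ^i_{jk}`. -/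
def chrMat (g : Field2) (x : Point) (k : Fin 4) : Matrix (Fin 4) (Fin 4) ℝ :=
  Matrix.of fun i j => christoffel g x i j k

/-- Lowering the index cancels the inverse metric and leaves the Christoffel symbols of the first
kind. -/
theorem metric_mul_chrMat {g : Field2} (hx : (g x).det ≠ 0) (i j k : Fin 4) :
    (g x * chrMat g x k) i j = (1 / 2) *
      (pd k (fun y => g y j i) x - pd i (fun y => g y j k) x + pd j (fun y => g y i k) x) := by
  set c : Fin 4 → ℝ := fun a =>
    (1 / 2) * (pd k (fun y => g y j a) x - pd a (fun y => g y j k) x + pd j (fun y => g y a k) x)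
    with hc
  have h : ∀ a, chrMat g x k a j = ((g x)⁻¹.mulVec c) a := by
    intro a
    simp only [chrMat, Matrix.of_apply, christoffel, Matrix.mulVec, dotProduct, Finset.mul_sum, hc]
    refine Finset.sum_congr rfl fun b _ => ?_
    ring
  have h' : (g x * chrMat g x k) i j = ((g x).mulVec ((g x)⁻¹.mulVec c)) i := by
    simp only [Matrix.mul_apply, Matrix.mulVec, dotProduct] at h ⊢
    exact Finset.sum_congr rfl fun a _ => by rw [h a]
  rw [h', Matrix.mulVec_mulVec, Matrix.mul_nonsing_inv _ (isUnit_iff_ne_zero.2 hx),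
    Matrix.one_mulVec]

/-- Metric compatibility in matrix form: adding the first-kind symbols with `i` and `j` exchanged
cancels all but the derivative in direction `k`. -/
theorem dirMat_metric {g : Field2} (hg : ∀ y, (g y).IsSymm) (hx : (g x).det ≠ 0) (k : Fin 4) :
    dirMat g x (Pi.single k 1) = (chrMat g x k).transpose * g x + g x * chrMat g x k := by
  have h : ∀ a b, (fun y => g y a b) = fun y => g y b a := fun a b => funext fun y => (hg y).apply b a
  have ht : (chrMat g x k).transpose * g x = (g x * chrMat g x k).transpose := by
    rw [Matrix.transpose_mul, (hg x).eq]
  ext i j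
  rw [ht, Matrix.add_apply, Matrix.transpose_apply, metric_mul_chrMat hx, metric_mul_chrMat hx,
    h j i, h j k, h i k]
  change pd k (fun y => g y i j) x = _
  ring

theorem trace_inv_mul_dirMat_metric {g : Field2} (hg : ∀ y, (g y).IsSymm) (hx : (g x).det ≠ 0)
    (k : Fin 4) :
    ((g x)⁻¹ * dirMat g x (Pi.single k 1)).trace = 2 * (chrMat g x k).trace := by
  have hu := isUnit_iff_ne_zero.2 hx
  rw [dirMat_metric hg hx, Matrix.mul_add, Matrix.trace_add, ← Matrix.mul_assoc (g x)⁻¹ (g x),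
    Matrix.nonsing_inv_mul _ hu, Matrix.one_mul, Matrix.trace_mul_comm, Matrix.mul_assoc,
    Matrix.mul_nonsing_inv _ hu, Matrix.mul_one, Matrix.trace_transpose]
  ring

theorem pd_inv_metric {g : Field2} (hg : ∀ y, (g y).IsSymm) (hx : (g x).det ≠ 0)
    (hd : ∀ i j, ContDiffAt ℝ 1 (fun y => g y i j) x) (i j k : Fin 4) :
    pd k (fun y => (g y)⁻¹ i j) x
      = -((g x)⁻¹ * (chrMat g x k).transpose) i j - (chrMat g x k * (g x)⁻¹) i j := by
  have hu := isUnit_iff_ne_zero.2 hx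
  change dirMat (fun y => (g y)⁻¹) x (Pi.single k 1) i j = _
  rw [dirMat_inv hd hx, dirMat_metric hg hx, Matrix.mul_add, Matrix.add_mul,
    ← Matrix.mul_assoc (g x)⁻¹ (g x), Matrix.nonsing_inv_mul _ hu, Matrix.one_mul,
    ← Matrix.mul_assoc (g x)⁻¹ _ (g x), Matrix.mul_assoc _ (g x) (g x)⁻¹,
    Matrix.mul_nonsing_inv _ hu, Matrix.mul_one, neg_add]
  simp [sub_eq_add_neg]

/-- Jacobi's formula combined with metric compatibility; the square root halves the factor 2 in the
trace. -/
theorem pd_volDensity {g : Field2} (hg : ∀ y, (g y).IsSymm) (hx : (g x).det ≠ 0)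
    (hd : ∀ i j, DifferentiableAt ℝ (fun y => g y i j) x) (k : Fin 4) :
    pd k (volDensity g) x = volDensity g x * (chrMat g x k).trace := by
  have h := fderiv_sqrt_abs (v := Pi.single k 1) (differentiableAt_det hd) hx
  rw [fderiv_det hd hx, inv_mul_cancel_left₀ hx, trace_inv_mul_dirMat_metric hg hx] at h
  rw [pd]
  refine h.trans ?_
  rw [volDensity]
  ring

theorem volDensity_pos {g : Field2} (hx : (g x).det ≠ 0) : 0 < volDensity g x :=
  Real.sqrt_pos.2 (abs_pos.2 hx)

/-! ### Symmetry of the Ricci curvature -/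

namespace SmoothMetricFam

/-- Being a gradient, the contracted symbol has symmetric first derivatives. This settles the one
term of the Ricci tensor whose symmetry is not algebraic. -/
theorem trace_chrMat (hγ : SmoothMetricFam δ U γ) (hU : IsOpen U) (he : e ∈ Set.Ioo (-δ) δ)
    (hx : x ∈ U) (k : Fin 4) :
    (chrMat (γ e) x k).trace = pd k (fun y => Real.log (GenRiem.volDensity (γ e) y)) x := by
  have hdet := hγ.det_ne_zero e he x hx
  have hv := volDensity_pos hdet
  rw [pd, fderiv.log ((hγ.volDensity hU).differentiableAt_space hU he hx) hv.ne']
  change _ = (GenRiem.volDensity (γ e) x)⁻¹ * pd k (GenRiem.volDensity (γ e)) x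
  rw [pd_volDensity (hγ.symm e) hdet
    (fun i j => (hγ.smooth i j).differentiableAt_space hU he hx), inv_mul_cancel_left₀ hv.ne']

theorem logVolDensity (hγ : SmoothMetricFam δ U γ) (hU : IsOpen U) :
    SmoothFam δ U (fun e x => Real.log (GenRiem.volDensity (γ e) x)) :=
  .of_contDiffAt fun e he x hx => ((hγ.volDensity hU).contDiffAt hU he hx).log
    (volDensity_pos (hγ.det_ne_zero e he x hx)).ne'

theorem sum_pd_christoffel (hγ : SmoothMetricFam δ U γ) (hU : IsOpen U)
    (he : e ∈ Set.Ioo (-δ) δ) (hx : x ∈ U) (i j : Fin 4) :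
    ∑ a, pd j (fun y => GenRiem.christoffel (γ e) y a i a) x
      = pd j (fun y => pd i (fun z => Real.log (GenRiem.volDensity (γ e) z)) y) x := by
  rw [← pd_sum fun a _ => (hγ.christoffel hU a i a).differentiableAt_space hU he hx]
  refine pd_congr ?_
  filter_upwards [hU.mem_nhds hx] with y hy
  rw [← hγ.trace_chrMat hU he hy]
  exact Finset.sum_congr rfl fun a _ => christoffel_symm (hγ.symm e) y a i a

theorem ricci_symm (hγ : SmoothMetricFam δ U γ) (hU : IsOpen U)
    (he : e ∈ Set.Ioo (-δ) δ) (hx : x ∈ U) (i j : Fin 4) :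
    GenRiem.ricci (γ e) x i j = GenRiem.ricci (γ e) x j i := by
  have hs := christoffel_symm (hγ.symm e)
  simp only [GenRiem.ricci, riemann, Finset.sum_sub_distrib, Finset.sum_add_distrib]
  rw [hγ.sum_pd_christoffel hU he hx, hγ.sum_pd_christoffel hU he hx,
    (hγ.logVolDensity hU).pd_pd hU he hx i j]
  have h1 : ∀ a, (fun y => GenRiem.christoffel (γ e) y a i j)
      = fun y => GenRiem.christoffel (γ e) y a j i := fun a => funext fun y => hs y a i j
  have h2 : ∑ a, ∑ b, GenRiem.christoffel (γ e) x b i a * GenRiem.christoffel (γ e) x a b j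
      = ∑ a, ∑ b, GenRiem.christoffel (γ e) x b j a * GenRiem.christoffel (γ e) x a b i := by
    rw [Finset.sum_comm]
    refine Finset.sum_congr rfl fun a _ => Finset.sum_congr rfl fun b _ => ?_
    rw [hs x a i b, hs x b a j, mul_comm]
  simp only [h1, h2, fun a => hs x a i j]

end SmoothMetricFam

end

/-! ### The Palatini identity -/

section PalatiniAlgebra

variable {ι : Type*} [Fintype ι]

theorem sum_rotate_left (f : ι → ι → ι → ℝ) :
    ∑ i, ∑ j, ∑ a, f i j a = ∑ a, ∑ i, ∑ j, f i j a := by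
  rw [Finset.sum_congr rfl fun i _ => Finset.sum_comm, Finset.sum_comm]

theorem sum_move_first_last (f : ι → ι → ι → ι → ℝ) :
    ∑ i, ∑ j, ∑ a, ∑ b, f i j a b = ∑ j, ∑ a, ∑ b, ∑ i, f i j a b := by
  rw [Finset.sum_comm]
  exact Finset.sum_congr rfl fun j _ => (sum_rotate_left fun a b i => f i j a b).symm

/-- The index bookkeeping of the Palatini identity, with `D` for `√|g| g^{ij}`, `C` for the
Christoffel symbols, `c` for their variation, and `dD`, `dc` for partial derivatives. Hypothesis
`hdD` says that the density `D` is covariantly constant, so the quadratic terms are exactly those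
produced by the product rule in the divergence. -/
theorem palatini_algebra (D : ι → ι → ℝ) (C c dD : ι → ι → ι → ℝ)
    (dc : ι → ι → ι → ι → ℝ) (hD : ∀ i j, D i j = D j i)
    (hC : ∀ i j k, C i j k = C i k j) (hc : ∀ i j k, c i j k = c i k j)
    (hdD : ∀ k i j, dD k i j
      = D i j * ∑ b, C b b k - ∑ b, D i b * C j b k - ∑ b, C i b k * D b j) :
    ∑ i, ∑ j, D i j * ∑ a, (dc a a i j - dc j a i a
        + ∑ b, (c b i j * C a b a + C b i j * c a b a)
        - ∑ b, (c b i a * C a b j + C b i a * c a b j))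
      = ∑ a, (∑ i, ∑ j, (dD a i j * c a i j + D i j * dc a a i j)
        - ∑ i, (dD a i a * ∑ b, c b i b + D i a * ∑ b, dc a b i b)) := by
  have p1 : ∑ i, ∑ j, ∑ a, D i j * dc a a i j = ∑ a, ∑ i, ∑ j, D i j * dc a a i j :=
    sum_rotate_left _
  have p2 : ∑ i, ∑ j, ∑ a, D i j * dc j a i a = ∑ a, ∑ i, ∑ b, D i a * dc a b i b :=
    Finset.sum_comm
  have t1 : ∑ i, ∑ j, ∑ a, ∑ b, D i j * (c b i j * C a b a)
      = ∑ a, ∑ i, ∑ j, ∑ b, D i j * C b b a * c a i j := by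
    rw [← sum_rotate_left fun i j a => ∑ b, D i j * C b b a * c a i j]
    refine Finset.sum_congr rfl fun i _ => Finset.sum_congr rfl fun j _ => ?_
    rw [Finset.sum_comm]
    refine Finset.sum_congr rfl fun a _ => Finset.sum_congr rfl fun b _ => ?_
    rw [hC b a b]
    ring
  have t2 : ∑ i, ∑ j, ∑ a, ∑ b, D i j * (C b i j * c a b a)
      = ∑ a, ∑ i, ∑ b, ∑ d, C i d a * D d a * c b i b := by
    rw [sum_move_first_last]
    refine Finset.sum_congr rfl fun a _ => ?_
    rw [Finset.sum_comm]
    refine Finset.sum_congr rfl fun i _ => Finset.sum_congr rfl fun b _ =>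
      Finset.sum_congr rfl fun d _ => ?_
    ring
  have t3 : ∑ i, ∑ j, ∑ a, ∑ b, D i j * (c b i a * C a b j)
      = ∑ a, ∑ i, ∑ j, ∑ b, C i b a * D b j * c a i j := by
    rw [sum_move_first_last, sum_move_first_last, Finset.sum_comm]
    refine Finset.sum_congr rfl fun a _ => Finset.sum_congr rfl fun i _ =>
      Finset.sum_congr rfl fun j _ => Finset.sum_congr rfl fun b _ => ?_
    rw [hD j b, hC i a b, hc a j i]
    ring
  have t4 : ∑ i, ∑ j, ∑ a, ∑ b, D i j * (C b i a * c a b j)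
      = ∑ a, ∑ i, ∑ j, ∑ b, D i b * C j b a * c a i j := by
    rw [sum_move_first_last, Finset.sum_comm]
    refine Finset.sum_congr rfl fun a _ => Finset.sum_congr rfl fun i _ =>
      Finset.sum_congr rfl fun j _ => Finset.sum_congr rfl fun b _ => ?_
    rw [hD b i, hc a j i]
    ring
  -- In the divergence `dD a i a` the density term and one connection term cancel; the surviving
  -- connection term is matched by `t2`.
  have r0 : ∑ a, ∑ i, ∑ b, ∑ d, D i a * C d d a * c b i b
      = ∑ a, ∑ i, ∑ b, ∑ d, D i d * C a d a * c b i b := by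
    rw [sum_move_first_last, sum_move_first_last fun a i b d => D i d * C a d a * c b i b]
    refine Finset.sum_congr rfl fun i _ => Finset.sum_congr rfl fun b _ => ?_
    rw [Finset.sum_comm]
    refine Finset.sum_congr rfl fun a _ => Finset.sum_congr rfl fun d _ => ?_
    rw [hC d d a]
  simp only [hdD, mul_add, mul_sub, sub_mul, Finset.mul_sum, Finset.sum_mul,
    Finset.sum_add_distrib, Finset.sum_sub_distrib]
  rw [p1, p2, t1, t2, t3, t4]
  linarith

end PalatiniAlgebra

/-! ### First variation of the Ricci tensor and of the scalar curvature density -/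

section

variable {δ : ℝ} {U : Set Point} {F H : ℝ → Point → ℝ} {e : ℝ} {x : Point} {γ : ℝ → Field2}

theorem SmoothFam.hasDerivAt (hF : SmoothFam δ U F) (hU : IsOpen U) (he : e ∈ Set.Ioo (-δ) δ)
    (hx : x ∈ U) : HasDerivAt (fun s => F s x) (GenRiem.dt F e x) e :=
  (hF.differentiableAt_param hU he hx).hasDerivAt

theorem SmoothFam.hasDerivAt_pd (hF : SmoothFam δ U F) (hU : IsOpen U)
    (he : e ∈ Set.Ioo (-δ) δ) (hx : x ∈ U) (k : Fin 4) :
    HasDerivAt (fun s => GenRiem.pd k (F s) x) (GenRiem.pd k (GenRiem.dt F e) x) e := by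
  rw [← hF.dt_pd hU he hx]
  exact (hF.pd hU k).hasDerivAt hU he hx

/-- The tensor density `√|g| g^{ij}`. -/
def invDensity (g : Field2) (x : Point) (i j : Fin 4) : ℝ := volDensity g x * (g x)⁻¹ i j

/-- The derivative `δΓ^i_{jk}` of the Christoffel symbols along a family of metrics. -/
def christoffelDot (γ : ℝ → Field2) (e : ℝ) : Field3 := fun x i j k =>
  dt (fun s y => christoffel (γ s) y i j k) e x

/-- The vector density `√|g| (g^{ij} δΓ^a_{ij} - g^{ia} δΓ^b_{ib})`. -/
def palatiniCurrent (γ : ℝ → Field2) (e : ℝ) (a : Fin 4) (x : Point) : ℝ :=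
  ∑ i, ∑ j, invDensity (γ e) x i j * christoffelDot γ e x a i j
    - ∑ i, invDensity (γ e) x i a * ∑ b, christoffelDot γ e x b i b

/-- Covariant constancy of the density `√|g| g^{ij}`, in the form needed for `hdD` in
`palatini_algebra`. -/
theorem pd_invDensity {g : Field2} (hg : ∀ y, (g y).IsSymm) (hx : (g x).det ≠ 0)
    (hd : ∀ i j, ContDiffAt ℝ 1 (fun y => g y i j) x) (k i j : Fin 4) :
    pd k (fun y => invDensity g y i j) x = invDensity g x i j * ∑ b, christoffel g x b b k
      - ∑ b, invDensity g x i b * christoffel g x j b k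
      - ∑ b, christoffel g x i b k * invDensity g x b j := by
  have hd' : ∀ i j, DifferentiableAt ℝ (fun y => g y i j) x :=
    fun i j => (hd i j).differentiableAt one_ne_zero
  have hv : DifferentiableAt ℝ (volDensity g) x :=
    (contDiffAt_sqrt_abs (m := 1) (contDiffAt_det hd) hx).differentiableAt one_ne_zero
  have hi : DifferentiableAt ℝ (fun y => (g y)⁻¹ i j) x :=
    (contDiffAt_inv_apply hd hx i j).differentiableAt one_ne_zero
  have h : pd k (fun y => invDensity g y i j) x = _ := pd_mul (k := k) hv hi
  rw [h, pd_volDensity hg hx hd', pd_inv_metric hg hx hd]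
  simp only [invDensity, chrMat, Matrix.trace, Matrix.diag_apply, Matrix.of_apply,
    Matrix.mul_apply, Matrix.transpose_apply, mul_sub, mul_neg, Finset.mul_sum, Finset.sum_mul]
  have h1 : ∀ b, christoffel g x i b k * (volDensity g x * (g x)⁻¹ b j)
      = volDensity g x * (christoffel g x i b k * (g x)⁻¹ b j) := fun b => by ring
  simp only [h1, mul_assoc]
  have h2 : ∀ b, christoffel g x b b k * (g x)⁻¹ i j = (g x)⁻¹ i j * christoffel g x b b k :=
    fun b => mul_comm _ _
  simp only [h2]
  ring

namespace SmoothMetricFam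

theorem invDensity (hγ : SmoothMetricFam δ U γ) (hU : IsOpen U) (i j : Fin 4) :
    SmoothFam δ U (fun e x => GenRiem.invDensity (γ e) x i j) :=
  (hγ.volDensity hU).mul (hγ.inv hU i j)

theorem christoffelDot (hγ : SmoothMetricFam δ U γ) (hU : IsOpen U) :
    SmoothFam3 δ U (GenRiem.christoffelDot γ) :=
  fun i j k => (hγ.christoffel hU i j k).dt hU

theorem palatiniCurrent (hγ : SmoothMetricFam δ U γ) (hU : IsOpen U) (a : Fin 4) :
    SmoothFam δ U (fun e => GenRiem.palatiniCurrent γ e a) :=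
  have hC := hγ.christoffelDot hU
  .sub (.sum fun i => .sum fun j => (hγ.invDensity hU i j).mul (hC a i j))
    (.sum fun i => (hγ.invDensity hU i a).mul (.sum fun b => hC b i b))

theorem hasDerivAt_ricci (hγ : SmoothMetricFam δ U γ) (hU : IsOpen U)
    (he : e ∈ Set.Ioo (-δ) δ) (hx : x ∈ U) (i j : Fin 4) :
    HasDerivAt (fun s => GenRiem.ricci (γ s) x i j)
      (∑ a, (GenRiem.pd a (fun y => GenRiem.christoffelDot γ e y a i j) x
        - GenRiem.pd j (fun y => GenRiem.christoffelDot γ e y a i a) x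
        + ∑ b, (GenRiem.christoffelDot γ e x b i j * GenRiem.christoffel (γ e) x a b a
            + GenRiem.christoffel (γ e) x b i j * GenRiem.christoffelDot γ e x a b a)
        - ∑ b, (GenRiem.christoffelDot γ e x b i a * GenRiem.christoffel (γ e) x a b j
            + GenRiem.christoffel (γ e) x b i a * GenRiem.christoffelDot γ e x a b j))) e := by
  have hC := hγ.christoffel hU
  have h1 := fun i j k => (hC i j k).hasDerivAt hU he hx
  have h2 := fun i j k => (hC i j k).hasDerivAt_pd hU he hx
  exact HasDerivAt.fun_sum fun a _ => (((h2 a i j a).sub (h2 a i a j)).add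
    (HasDerivAt.fun_sum fun b _ => (h1 b i j).mul (h1 a b a))).sub
    (HasDerivAt.fun_sum fun b _ => (h1 b i a).mul (h1 a b j))

theorem pd_palatiniCurrent (hγ : SmoothMetricFam δ U γ) (hU : IsOpen U)
    (he : e ∈ Set.Ioo (-δ) δ) (hx : x ∈ U) (a : Fin 4) :
    GenRiem.pd a (GenRiem.palatiniCurrent γ e a) x
      = ∑ i, ∑ j, (GenRiem.pd a (fun y => GenRiem.invDensity (γ e) y i j) x
            * GenRiem.christoffelDot γ e x a i j
          + GenRiem.invDensity (γ e) x i j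
            * GenRiem.pd a (fun y => GenRiem.christoffelDot γ e y a i j) x)
        - ∑ i, (GenRiem.pd a (fun y => GenRiem.invDensity (γ e) y i a) x
            * ∑ b, GenRiem.christoffelDot γ e x b i b
          + GenRiem.invDensity (γ e) x i a
            * ∑ b, GenRiem.pd a (fun y => GenRiem.christoffelDot γ e y b i b) x) := by
  have hC := fun i j k => (hγ.christoffelDot hU i j k).differentiableAt_space hU he hx
  have hD := fun i j => (hγ.invDensity hU i j).differentiableAt_space hU he hx
  have hS := fun i => DifferentiableAt.fun_sum (u := Finset.univ) fun b _ => hC b i b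
  have h := pd_sub (k := a) (x := x)
    (DifferentiableAt.fun_sum (u := Finset.univ) fun i _ =>
      DifferentiableAt.fun_sum (u := Finset.univ) fun j _ => (hD i j).fun_mul (hC a i j))
    (DifferentiableAt.fun_sum (u := Finset.univ) fun i _ => (hD i a).fun_mul (hS i))
  refine h.trans ?_
  rw [pd_sum fun i _ => DifferentiableAt.fun_sum fun j _ => (hD i j).fun_mul (hC a i j),
    pd_sum fun i _ => (hD i a).fun_mul (hS i)]
  congr 1
  · refine Finset.sum_congr rfl fun i _ => ?_
    rw [pd_sum fun j _ => (hD i j).fun_mul (hC a i j)]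
    exact Finset.sum_congr rfl fun j _ => pd_mul (hD i j) (hC a i j)
  · refine Finset.sum_congr rfl fun i _ => ?_
    rw [pd_mul (hD i a) (hS i), pd_sum fun b _ => hC b i b]

/-- The Palatini identity `√|g| g^{ij} δR_{ij} = ∂_a (√|g| (g^{ij} δΓ^a_{ij} - g^{ia} δΓ^b_{ib}))`. -/
theorem sum_invDensity_mul_dt_ricci (hγ : SmoothMetricFam δ U γ) (hU : IsOpen U)
    (he : e ∈ Set.Ioo (-δ) δ) (hx : x ∈ U) :
    ∑ i, ∑ j, GenRiem.invDensity (γ e) x i j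
        * GenRiem.dt (fun s y => GenRiem.ricci (γ s) y i j) e x
      = ∑ a, GenRiem.pd a (GenRiem.palatiniCurrent γ e a) x := by
  have hdet := hγ.det_ne_zero e he x hx
  have hs : ∀ i j k, GenRiem.christoffelDot γ e x i j k = GenRiem.christoffelDot γ e x i k j := by
    intro i j k
    simp only [GenRiem.christoffelDot]
    congr 1
    funext s y
    exact christoffel_symm (hγ.symm s) y i j k
  have hD : ∀ i j, GenRiem.invDensity (γ e) x i j = GenRiem.invDensity (γ e) x j i := by
    intro i j
    have : ((γ e x)⁻¹).IsSymm := by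
      rw [Matrix.IsSymm, Matrix.transpose_nonsing_inv, (hγ.symm e x).eq]
    rw [GenRiem.invDensity, GenRiem.invDensity, this.apply i j]
  have hd : ∀ i j, ContDiffAt ℝ 1 (fun y => γ e y i j) x := fun i j =>
    ((hγ.smooth i j).contDiffAt_space hU he hx).of_le (by simp)
  have h : ∀ i j, GenRiem.dt (fun s y => GenRiem.ricci (γ s) y i j) e x = _ :=
    fun i j => (hγ.hasDerivAt_ricci hU he hx i j).deriv
  simp only [h, hγ.pd_palatiniCurrent hU he hx]
  exact palatini_algebra _ (GenRiem.christoffel (γ e) x) (GenRiem.christoffelDot γ e x)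
    (fun k i j => GenRiem.pd k (fun y => GenRiem.invDensity (γ e) y i j) x)
    (fun k a i j => GenRiem.pd k (fun y => GenRiem.christoffelDot γ e y a i j) x) hD
    (christoffel_symm (hγ.symm e) x) hs (fun k i j => pd_invDensity (hγ.symm e) hdet hd k i j)

theorem dt_volDensity_mul_scalarCurv (hγ : SmoothMetricFam δ U γ) (hU : IsOpen U)
    (he : e ∈ Set.Ioo (-δ) δ) (hx : x ∈ U) :
    GenRiem.dt (fun s y => GenRiem.volDensity (γ s) y * GenRiem.scalarCurv (γ s) y) e x
      = ∑ i, ∑ j, GenRiem.dt (fun s y => GenRiem.invDensity (γ s) y i j) e x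
            * GenRiem.ricci (γ e) x i j
        + ∑ a, GenRiem.pd a (GenRiem.palatiniCurrent γ e a) x := by
  have h : (fun s y => GenRiem.volDensity (γ s) y * GenRiem.scalarCurv (γ s) y)
      = fun s y => ∑ i, ∑ j, GenRiem.invDensity (γ s) y i j * GenRiem.ricci (γ s) y i j := by
    funext s y
    simp only [GenRiem.scalarCurv, GenRiem.invDensity, Finset.mul_sum, mul_assoc]
  rw [h, ← hγ.sum_invDensity_mul_dt_ricci hU he hx, ← Finset.sum_add_distrib]
  simp only [← Finset.sum_add_distrib]
  exact (HasDerivAt.fun_sum fun i _ => HasDerivAt.fun_sum fun j _ =>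
    ((hγ.invDensity hU i j).hasDerivAt hU he hx).mul
      ((hγ.ricci hU i j).hasDerivAt hU he hx)).deriv

end SmoothMetricFam

end

section

variable {δ : ℝ} {U K : Set Point} {F : ℝ → Point → ℝ} {x : Point}

/-! ### Integration -/

theorem integrableOn_of_continuousOn {f : Point → ℝ} (hf : ContinuousOn f U) (hK : IsCompact K)
    (hKU : K ⊆ U) : IntegrableOn f K :=
  (hf.mono hKU).integrableOn_compact hK

/-- Dominated differentiation under the integral. Halving the interval makes the parameter range
compact, so the derivative is bounded by a constant on its product with `K`. -/
theorem SmoothFam.hasDerivAt_setIntegral (hF : SmoothFam δ U F) (hδ : 0 < δ) (hU : IsOpen U)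
    (hK : IsCompact K) (hKU : K ⊆ U) :
    HasDerivAt (fun e => ∫ x in K, F e x) (∫ x in K, GenRiem.dt F 0 x) 0 := by
  have hsub : Set.Icc (-(δ / 2)) (δ / 2) ⊆ Set.Ioo (-δ) δ := fun e he =>
    ⟨by linarith [he.1], by linarith [he.2]⟩
  have hcont : ContinuousOn (fun q : ℝ × Point => GenRiem.dt F q.1 q.2)
      (Set.Icc (-(δ / 2)) (δ / 2) ×ˢ K) :=
    (ContDiffOn.continuousOn (hF.dt hU)).mono (Set.prod_mono hsub hKU)
  obtain ⟨C, hC⟩ := (isCompact_Icc.prod hK).exists_bound_of_continuousOn hcont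
  have hint : ∀ {H : ℝ → Point → ℝ}, SmoothFam δ U H → ∀ e ∈ Set.Ioo (-δ) δ,
      IntegrableOn (H e) K := fun hH e he =>
    integrableOn_of_continuousOn (hH.continuousOn he) hK hKU
  have h0 : (0 : ℝ) ∈ Set.Ioo (-δ) δ := ⟨by linarith, hδ⟩
  refine (hasDerivAt_integral_of_dominated_loc_of_deriv_le (bound := fun _ => C)
    (F' := GenRiem.dt F) (Icc_mem_nhds (by linarith : -(δ / 2) < 0) (by linarith : 0 < δ / 2))
    ?_ (hint hF 0 h0) (hint (hF.dt hU) 0 h0).aestronglyMeasurable ?_ ?_ ?_).2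
  · filter_upwards [isOpen_Ioo.mem_nhds h0] with e he
    exact (hint hF e he).aestronglyMeasurable
  · filter_upwards [ae_restrict_mem hK.measurableSet] with x hx e he
    exact hC (e, x) ⟨he, hx⟩
  · exact integrableOn_const hK.measure_lt_top.ne
  · filter_upwards [ae_restrict_mem hK.measurableSet] with x hx e he
    exact hF.hasDerivAt hU (hsub he) (hKU hx)

theorem integral_pd_eq_zero {f : Point → ℝ} (hf : ContDiff ℝ 1 f) (hs : HasCompactSupport f)
    (k : Fin 4) : ∫ x, pd k f x = 0 := by
  have hc : Continuous fun x => fderiv ℝ f x (Pi.single k 1) :=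
    (hf.continuous_fderiv one_ne_zero).clm_apply continuous_const
  have hsupp : HasCompactSupport fun x => fderiv ℝ f x (Pi.single k 1) :=
    (hs.fderiv (𝕜 := ℝ)).comp_left (g := fun L : Point →L[ℝ] ℝ => L (Pi.single k 1)) rfl
  have h := integral_mul_fderiv_eq_neg_fderiv_mul_of_integrable (μ := (volume : Measure Point))
    (f := fun _ => (1 : ℝ)) (g := f) (v := Pi.single k 1) (by simp)
    (by simpa using hc.integrable_of_hasCompactSupport hsupp)
    (by simpa using hf.continuous.integrable_of_hasCompactSupport hs)
    (fun x _ => differentiableAt_const _) (fun x _ => hf.differentiable one_ne_zero x)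
  simpa [pd] using h

/-- Vanishing off the compact set `S` makes `f` of class C¹ on the whole space and lets the integral
over `K` be taken over the whole space. No regularity of the boundary of `K` is needed. -/
theorem setIntegral_pd_eq_zero {f : Point → ℝ} {S : Set Point} (hU : IsOpen U)
    (hf : ContDiffOn ℝ 1 f U) (hS : IsCompact S) (hSU : S ⊆ U) (hSK : S ⊆ K)
    (h0 : ∀ x ∉ S, f x = 0) (k : Fin 4) : ∫ x in K, pd k f x = 0 := by
  have hev : ∀ x ∉ S, f =ᶠ[nhds x] fun _ => 0 := fun x hx => by
    filter_upwards [hS.isClosed.isOpen_compl.mem_nhds hx] with y hy using h0 y hy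
  have hf' : ContDiff ℝ 1 f := contDiff_iff_contDiffAt.2 fun x => by
    by_cases hx : x ∈ S
    · exact hf.contDiffAt (hU.mem_nhds (hSU hx))
    · exact contDiffAt_const.congr_of_eventuallyEq (hev x hx)
  rw [setIntegral_eq_integral_of_forall_compl_eq_zero,
    integral_pd_eq_zero hf' (HasCompactSupport.intro hS h0)]
  intro x hx
  rw [pd, (hev x fun h => hx (hSK h)).fderiv_eq]
  simp

theorem continuousOn_pairing {A B : Field2} (hA : ∀ i j, ContinuousOn (fun x => A x i j) U)
    (hB : ∀ i j, ContinuousOn (fun x => B x i j) U) :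
    ContinuousOn (fun x => pairing (A x) (B x)) U :=
  continuousOn_finsetSum _ fun i _ => continuousOn_finsetSum _ fun j _ => (hA i j).mul (hB i j)

/-- The fundamental lemma of the calculus of variations for symmetric tensor fields. -/
theorem eq_zero_of_forall_setIntegral_pairing_eq_zero (hU : IsOpen U) {v : Point → ℝ}
    (hv : ContinuousOn v U) (hv0 : ∀ x ∈ U, v x ≠ 0) {A : Field2} (hA : IsSymmField U A)
    (h : ∀ h, IsVariation U h → ∀ K, IsCompact K → tsupport h ⊆ K → K ⊆ U →
      ∫ x in K, v x * pairing (A x) (h x) = 0) :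
    ∀ x ∈ U, A x = 0 := by
  intro x hx
  ext i j
  have hc : ContinuousOn (fun y => v y * (A y i j + A y j i)) U :=
    hv.mul ((hA.cont i j).add (hA.cont j i))
  have hae : ∀ᵐ y, y ∈ U → v y * (A y i j + A y j i) = 0 := by
    refine hU.ae_eq_zero_of_integral_contDiff_smul_eq_zero
      (hc.locallyIntegrableOn hU.measurableSet) fun φ hφ hφc hφU => ?_
    -- Only symmetric variations are admissible, so the test field isolates `A i j + A j i`;
    -- symmetry of `A` recovers the single entry at the end.
    set η : Field2 := fun y => φ y • (Matrix.single i j 1 + Matrix.single j i 1) with hη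
    have hsub : tsupport η ⊆ tsupport φ := closure_mono fun y hy hφy => hy (by simp [hη, hφy])
    have hvar : IsVariation U η :=
      { smooth := fun a b => by
          simp only [hη, Matrix.smul_apply, smul_eq_mul]
          exact hφ.mul contDiff_const
        symm := fun y => by
          rw [Matrix.IsSymm, Matrix.transpose_smul, Matrix.transpose_add, Matrix.transpose_single,
            Matrix.transpose_single, add_comm]
        compact := hφc.of_isClosed_subset isClosed_closure hsub
        support := hsub.trans hφU }
    have key := h η hvar (tsupport φ) hφc hsub hφU
    have hp : ∀ y, v y * pairing (A y) (η y) = φ y • (v y * (A y i j + A y j i)) := by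
      intro y
      have : pairing (A y) (η y) = φ y * (A y i j + A y j i) := by
        simp [pairing, hη, Matrix.single_apply, mul_add, Finset.sum_add_distrib, ite_and]
        ring
      rw [this, smul_eq_mul]
      ring
    simp only [hp] at key
    rwa [setIntegral_eq_integral_of_forall_compl_eq_zero] at key
    intro y hy
    rw [image_eq_zero_of_notMem_tsupport hy, zero_smul]
  have h0 := Measure.eqOn_open_of_ae_eq (μ := (volume : Measure Point)) (g := fun _ => (0 : ℝ))
    ((ae_restrict_iff' hU.measurableSet).2 hae) hU hc continuousOn_const hx
  have hs := (hA.symm x hx).apply i j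
  rcases mul_eq_zero.1 h0 with h1 | h1
  · exact absurd h1 (hv0 x hx)
  · rw [Matrix.zero_apply]
    linarith

end

section

variable {U K : Set Point} {G h : Field2} {x : Point} {e : ℝ}

/-! ### Variations of a generalized metric -/

theorem symPart_isSymm (G : Field2) (x : Point) : (symPart G x).IsSymm := by
  rw [Matrix.IsSymm, symPart, Matrix.transpose_smul, Matrix.transpose_add,
    Matrix.transpose_transpose, add_comm]

theorem vary_zero (G h : Field2) : vary G h 0 = G := by
  funext x
  simp [vary]

theorem vary_of_eq_zero (hx : h x = 0) (e : ℝ) : vary G h e x = G x := by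
  simp [vary, hx]

/-- The increment in `vary` is symmetric, so it leaves the anti-symmetric part alone and moves the
symmetric part to the required inverse. -/
theorem symPart_vary (hh : (h x).IsSymm) (hx : (symPart G x).det ≠ 0) (e : ℝ) :
    symPart (vary G h e) x = ((symPart G x)⁻¹ + e • h x)⁻¹ := by
  have hu := isUnit_iff_ne_zero.2 hx
  set M : Matrix (Fin 4) (Fin 4) ℝ := ((symPart G x)⁻¹ + e • h x)⁻¹ with hM
  have hMs : M.transpose = M := by
    rw [hM, Matrix.transpose_nonsing_inv, Matrix.transpose_add, Matrix.transpose_smul,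
      Matrix.transpose_nonsing_inv, hh.eq, (symPart_isSymm G x).eq]
  have hv : vary G h e x = G x + (M - symPart G x) := by
    rw [vary, ← hM, Matrix.nonsing_inv_nonsing_inv _ hu]
  rw [symPart, hv, Matrix.transpose_add, Matrix.transpose_sub, hMs, (symPart_isSymm G x).eq]
  have : G x + (M - symPart G x) + ((G x).transpose + (M - symPart G x))
      = (G x + (G x).transpose) + (2 : ℝ) • (M - symPart G x) := by
    rw [two_smul]
    abel
  rw [this, smul_add, smul_smul]
  change symPart G x + _ = M
  norm_num

theorem isVariation_zero (U : Set Point) : IsVariation U (0 : Field2) where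
  smooth := fun _ _ => contDiff_const
  symm := fun _ => Matrix.transpose_zero
  compact := HasCompactSupport.zero
  support := by simp [tsupport]

namespace IsGeneralizedMetric

theorem contDiffOn_symPart (hG : IsGeneralizedMetric U G) (i j : Fin 4) :
    ContDiffOn ℝ ∞ (fun x => symPart G x i j) U :=
  contDiffOn_const.mul ((hG.smooth i j).add (hG.smooth j i))

theorem contDiffAt_inv_add (hG : IsGeneralizedMetric U G) (hU : IsOpen U)
    (hh : IsVariation U h) (e : ℝ) (hx : x ∈ U) (i j : Fin 4) :
    ContDiffAt ℝ ∞ (fun q : ℝ × Point => ((symPart G q.2)⁻¹ + q.1 • h q.2) i j) (e, x) := by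
  have h1 := contDiffAt_inv_apply (A := fun y => symPart G y)
    (fun i j => (hG.contDiffOn_symPart i j).contDiffAt (hU.mem_nhds hx))
    (hG.nondegenerate x hx) i j
  have h2 : ContDiffAt ℝ ∞ (fun q : ℝ × Point => h q.2 i j) (e, x) :=
    (hh.smooth i j).contDiffAt.comp (e, x) contDiffAt_snd
  exact (h1.comp (e, x) contDiffAt_snd).add (contDiffAt_fst.mul h2)

theorem det_inv_ne_zero (hG : IsGeneralizedMetric U G) (hx : x ∈ U) :
    ((symPart G x)⁻¹).det ≠ 0 := by
  rw [Matrix.det_nonsing_inv, Ring.inverse_eq_inv']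
  exact inv_ne_zero (hG.nondegenerate x hx)

/-- `U` need not be compact, but off the support of `h` the matrix does not depend on `e`. The tube
lemma around `{0} ×ˢ tsupport h` therefore yields a uniform `δ`. -/
theorem exists_det_inv_add_ne_zero (hG : IsGeneralizedMetric U G) (hU : IsOpen U)
    (hh : IsVariation U h) :
    ∃ δ : ℝ, 0 < δ ∧ ∀ e ∈ Set.Ioo (-δ) δ, ∀ x ∈ U, ((symPart G x)⁻¹ + e • h x).det ≠ 0 := by
  set N : Set (ℝ × Point) := {q | q.2 ∈ U ∧ ((symPart G q.2)⁻¹ + q.1 • h q.2).det ≠ 0}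
  have hN : IsOpen N := isOpen_iff_mem_nhds.2 fun q hq => by
    have hc := (contDiffAt_det (A := fun q : ℝ × Point => (symPart G q.2)⁻¹ + q.1 • h q.2)
      (hG.contDiffAt_inv_add hU hh q.1 hq.1)).continuousAt
    exact Filter.inter_mem (continuousAt_snd (hU.mem_nhds hq.1)) (hc.eventually_ne hq.2)
  have hsub : ({0} : Set ℝ) ×ˢ tsupport h ⊆ N := by
    rintro ⟨e, x⟩ ⟨he, hx⟩
    obtain rfl : e = 0 := he
    exact ⟨hh.support hx, by simpa using hG.det_inv_ne_zero (hh.support hx)⟩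
  obtain ⟨u, v, hu, -, hu0, hv, huv⟩ :=
    generalized_tube_lemma isCompact_singleton hh.compact hN hsub
  obtain ⟨δ, hδ, hball⟩ := Metric.isOpen_iff.1 hu 0 (hu0 rfl)
  refine ⟨δ, hδ, fun e he x hx => ?_⟩
  by_cases hxs : x ∈ tsupport h
  · have hmem : e ∈ Metric.ball (0 : ℝ) δ := by
      rw [Real.ball_eq_Ioo]
      simpa using he
    exact (huv (show (e, x) ∈ u ×ˢ v from ⟨hball hmem, hv hxs⟩)).2
  · rw [image_eq_zero_of_notMem_tsupport hxs, smul_zero, add_zero]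
    exact hG.det_inv_ne_zero hx

theorem smoothMetricFam {δ : ℝ} (hG : IsGeneralizedMetric U G) (hU : IsOpen U)
    (hh : IsVariation U h)
    (hδ : ∀ e ∈ Set.Ioo (-δ) δ, ∀ x ∈ U, ((symPart G x)⁻¹ + e • h x).det ≠ 0) :
    SmoothMetricFam δ U (fun e => symPart (vary G h e)) where
  smooth := fun i j => by
    refine SmoothFam.congr (F := fun e x => ((symPart G x)⁻¹ + e • h x)⁻¹ i j)
      (.of_contDiffAt fun e he x hx => ?_) fun e _ x hx => ?_
    · exact contDiffAt_inv_apply (A := fun q : ℝ × Point => (symPart G q.2)⁻¹ + q.1 • h q.2)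
        (hG.contDiffAt_inv_add hU hh e hx) (hδ e he x hx) i j
    · rw [symPart_vary (hh.symm x) (hG.nondegenerate x hx)]
  symm := fun e x => symPart_isSymm _ x
  det_ne_zero := fun e he x hx => by
    rw [symPart_vary (hh.symm x) (hG.nondegenerate x hx), Matrix.det_nonsing_inv,
      Ring.inverse_eq_inv']
    exact inv_ne_zero (hδ e he x hx)

theorem inv_symPart_vary (hG : IsGeneralizedMetric U G) (hh : IsVariation U h) (hx : x ∈ U)
    (he : ((symPart G x)⁻¹ + e • h x).det ≠ 0) :
    (symPart (vary G h e) x)⁻¹ = (symPart G x)⁻¹ + e • h x := by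
  rw [symPart_vary (hh.symm x) (hG.nondegenerate x hx),
    Matrix.nonsing_inv_nonsing_inv _ (isUnit_iff_ne_zero.2 he)]

theorem hasDerivAt_inv_symPart_vary {δ : ℝ} (hG : IsGeneralizedMetric U G)
    (hh : IsVariation U h) (hδ0 : 0 < δ)
    (hδ : ∀ e ∈ Set.Ioo (-δ) δ, ∀ x ∈ U, ((symPart G x)⁻¹ + e • h x).det ≠ 0) (hx : x ∈ U)
    (i j : Fin 4) :
    HasDerivAt (fun e => (symPart (vary G h e) x)⁻¹ i j) (h x i j) 0 := by
  have h1 : HasDerivAt (fun e : ℝ => (symPart G x)⁻¹ i j + e * h x i j) (1 * h x i j) 0 :=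
    ((hasDerivAt_id (0 : ℝ)).mul_const _).const_add _
  rw [one_mul] at h1
  refine h1.congr_of_eventuallyEq ?_
  filter_upwards [isOpen_Ioo.mem_nhds (show (0 : ℝ) ∈ Set.Ioo (-δ) δ from ⟨by linarith, hδ0⟩)]
    with e he
  rw [hG.inv_symPart_vary hh hx (hδ e he x hx)]
  rfl

theorem hasDerivAt_volDensity_vary (hG : IsGeneralizedMetric U G)
    (hh : IsVariation U h) (hx : x ∈ U) :
    HasDerivAt (fun e => volDensity (symPart (vary G h e)) x)
      (-(1 / 2) * volDensity (symPart G) x * pairing (symPart G x) (h x)) 0 := by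
  have hu := isUnit_iff_ne_zero.2 (hG.nondegenerate x hx)
  set B : ℝ → Matrix (Fin 4) (Fin 4) ℝ := fun e => (symPart G x)⁻¹ + e • h x with hB
  have hB0 : B 0 = (symPart G x)⁻¹ := by simp [hB]
  have hdet : (B 0).det ≠ 0 := hB0 ▸ hG.det_inv_ne_zero hx
  have hd : ∀ i j, ContDiffAt ℝ 1 (fun e => B e i j) 0 := fun i j =>
    contDiffAt_const.add (contDiffAt_id.mul contDiffAt_const)
  have hdir : dirMat B 0 1 = h x := by
    ext i j
    have h1 : HasDerivAt (fun e : ℝ => B e i j) (1 * h x i j) 0 :=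
      ((hasDerivAt_id (0 : ℝ)).mul_const _).const_add _
    rw [dirMat, Matrix.of_apply, fderiv_apply_one_eq_deriv, h1.deriv, one_mul]
  have hinv : (B 0)⁻¹ = symPart G x := by rw [hB0, Matrix.nonsing_inv_nonsing_inv _ hu]
  have hdi : ∀ i j, ContDiffAt ℝ 1 (fun e => (B e)⁻¹ i j) 0 := contDiffAt_inv_apply hd hdet
  have hdi' : ∀ i j, DifferentiableAt ℝ (fun e => (B e)⁻¹ i j) 0 :=
    fun i j => (hdi i j).differentiableAt one_ne_zero
  have hdet' : ((B 0)⁻¹).det ≠ 0 := hinv ▸ hG.nondegenerate x hx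
  have key := fderiv_sqrt_abs (v := 1) (differentiableAt_det hdi') hdet'
  rw [fderiv_det hdi' hdet', inv_mul_cancel_left₀ hdet', dirMat_inv hd hdet, hdir, hinv,
    Matrix.mul_neg, Matrix.trace_neg, ← Matrix.mul_assoc, ← Matrix.mul_assoc,
    Matrix.nonsing_inv_mul _ hu, Matrix.one_mul, fderiv_apply_one_eq_deriv] at key
  have htr : (h x * symPart G x).trace = pairing (symPart G x) (h x) := by
    rw [Matrix.trace_mul_comm]
    simp only [Matrix.trace, Matrix.diag_apply, Matrix.mul_apply, pairing]
    refine Finset.sum_congr rfl fun i _ => Finset.sum_congr rfl fun j _ => ?_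
    rw [(hh.symm x).apply i j]
  have hfun : (fun e => volDensity (symPart (vary G h e)) x)
      = fun e => Real.sqrt |((B e)⁻¹).det| := by
    funext e
    rw [volDensity, symPart_vary (hh.symm x) (hG.nondegenerate x hx)]
  have hdiff : DifferentiableAt ℝ (fun e => Real.sqrt |((B e)⁻¹).det|) 0 :=
    (contDiffAt_sqrt_abs (m := 1) (contDiffAt_det hdi) hdet').differentiableAt one_ne_zero
  rw [hfun]
  refine hdiff.hasDerivAt.congr_deriv (key.trans ?_)
  rw [htr, volDensity]
  ring

end IsGeneralizedMetric

/-- Off the closed support the metric is independent of the parameter on a whole neighbourhood, so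
its space derivatives are too. -/
theorem christoffelDot_eq_zero (hx : x ∉ tsupport h) (e : ℝ) (i j k : Fin 4) :
    christoffelDot (fun s => symPart (vary G h s)) e x i j k = 0 := by
  have hev : ∀ s, ∀ᶠ y in nhds x, symPart (vary G h s) y = symPart G y := fun s => by
    filter_upwards [(isClosed_tsupport h).isOpen_compl.mem_nhds hx] with y hy
    rw [symPart, vary_of_eq_zero (image_eq_zero_of_notMem_tsupport hy), symPart]
  have hc : ∀ s, christoffel (symPart (vary G h s)) x i j k = christoffel (symPart G) x i j k := by
    intro s
    have hpd : ∀ k i j, pd k (fun y => symPart (vary G h s) y i j) x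
        = pd k (fun y => symPart G y i j) x := fun k i j =>
      pd_congr ((hev s).mono fun y hy => by simp only [hy])
    simp only [christoffel, hpd, (hev s).self_of_nhds]
  simp only [christoffelDot, dt, hc, deriv_const]

theorem palatiniCurrent_eq_zero (hx : x ∉ tsupport h) (e : ℝ) (a : Fin 4) :
    palatiniCurrent (fun s => symPart (vary G h s)) e a x = 0 := by
  simp [palatiniCurrent, christoffelDot_eq_zero hx]

end

section

variable {U K : Set Point} {G h V : Field2} {x : Point} {e δ Λ : ℝ} {L : Lagrangian}

/-! ### Linearity of the contraction -/

section Pairing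

variable (A A' B : Matrix (Fin 4) (Fin 4) ℝ)

theorem pairing_add : pairing (A + A') B = pairing A B + pairing A' B := by
  simp only [pairing, Matrix.add_apply, add_mul, Finset.sum_add_distrib]

theorem pairing_smul (c : ℝ) : pairing (c • A) B = c * pairing A B := by
  simp only [pairing, Matrix.smul_apply, smul_eq_mul, Finset.mul_sum, mul_assoc]

theorem pairing_neg : pairing (-A) B = -pairing A B := by
  simp only [pairing, Matrix.neg_apply, neg_mul, Finset.sum_neg_distrib]

theorem pairing_sub : pairing (A - A') B = pairing A B - pairing A' B := by
  rw [sub_eq_add_neg, pairing_add, pairing_neg, sub_eq_add_neg]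

end Pairing

/-! ### The first variation of the action -/

/-- The Lagrangian is smooth along every variation of `G`. -/
def IsSmoothLagrangian (U : Set Point) (G : Field2) (L : Lagrangian) : Prop :=
  ∀ h, IsVariation U h → ∃ δ > 0, SmoothFam δ U (fun e x => L (vary G h e) x)

/-- The specific form of the matter Lagrangian matters only here; the variational argument below
works for any Lagrangian smooth along variations. -/
theorem isSmoothLagrangian_matterLagrangian (hU : IsOpen U) (hG : IsGeneralizedMetric U G)
    {conn : Field2 → Field3} (hconn : IsSmoothConnectionLaw U G conn) (u v w : ℝ) :
    IsSmoothLagrangian U G (matterLagrangian u v w conn) := fun h hh => by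
  obtain ⟨δ₁, hδ₁, h₁⟩ := hG.exists_det_inv_add_ne_zero hU hh
  obtain ⟨δ₂, hδ₂, h₂⟩ := hconn h hh
  have hle : Set.Ioo (-min δ₁ δ₂) (min δ₁ δ₂) ⊆ Set.Ioo (-δ₁) δ₁ :=
    Set.Ioo_subset_Ioo (neg_le_neg (min_le_left _ _)) (min_le_left _ _)
  refine ⟨min δ₁ δ₂, lt_min hδ₁ hδ₂, ?_⟩
  exact (hG.smoothMetricFam hU hh fun e he => h₁ e (hle he)).matterScalar
    (A := fun e => conn (vary G h e)) (fun i j k => SmoothFam.mono (h₂ i j k) (min_le_right _ _))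
    hU u v w

/-- Near a smooth Lagrangian and a generalized metric, everything is smooth along a variation. -/
theorem IsGeneralizedMetric.exists_smoothFam (hG : IsGeneralizedMetric U G) (hU : IsOpen U)
    (hL : IsSmoothLagrangian U G L) (hh : IsVariation U h) :
    ∃ δ : ℝ, 0 < δ ∧ (∀ e ∈ Set.Ioo (-δ) δ, ∀ x ∈ U, ((symPart G x)⁻¹ + e • h x).det ≠ 0) ∧
      SmoothMetricFam δ U (fun e => symPart (vary G h e)) ∧
      SmoothFam δ U (fun e x => L (vary G h e) x) := by
  obtain ⟨δ₁, hδ₁, h₁⟩ := hG.exists_det_inv_add_ne_zero hU hh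
  obtain ⟨δ₂, hδ₂, h₂⟩ := hL h hh
  have hle : Set.Ioo (-min δ₁ δ₂) (min δ₁ δ₂) ⊆ Set.Ioo (-δ₁) δ₁ :=
    Set.Ioo_subset_Ioo (neg_le_neg (min_le_left _ _)) (min_le_left _ _)
  exact ⟨min δ₁ δ₂, lt_min hδ₁ hδ₂, fun e he => h₁ e (hle he),
    hG.smoothMetricFam hU hh fun e he => h₁ e (hle he), h₂.mono (min_le_right _ _)⟩

theorem IsGeneralizedMetric.continuousOn_volDensity (hG : IsGeneralizedMetric U G) :
    ContinuousOn (volDensity (symPart G)) U := by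
  have hc : Continuous fun x : Matrix (Fin 4) (Fin 4) ℝ => x.det :=
    Continuous.matrix_det continuous_id
  have hm : ContinuousOn (symPart G) U :=
    continuousOn_pi.2 fun i => continuousOn_pi.2 fun j => (hG.contDiffOn_symPart i j).continuousOn
  exact ((hc.comp_continuousOn hm).abs).sqrt

theorem IsGeneralizedMetric.smoothMetricFam_const (hG : IsGeneralizedMetric U G) :
    SmoothMetricFam 1 U (fun _ => symPart G) where
  smooth := fun i j => .const (hG.contDiffOn_symPart i j)
  symm := fun _ x => symPart_isSymm G x
  det_ne_zero := fun _ _ x hx => hG.nondegenerate x hx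

/-- The zero variation is admissible, so smoothness along variations already contains regularity of
`L G` itself. -/
theorem IsSmoothLagrangian.continuousOn (hL : IsSmoothLagrangian U G L) :
    ContinuousOn (L G) U := by
  obtain ⟨δ, hδ, h⟩ := hL 0 (isVariation_zero U)
  have := h.continuousOn (e := 0) ⟨by linarith, hδ⟩
  rwa [vary_zero] at this

theorem hasDerivAt_volDensity_mul_lagrangian (hG : IsGeneralizedMetric U G) (hU : IsOpen U)
    (hh : IsVariation U h) (hδ : 0 < δ) (hL : SmoothFam δ U (fun e x => L (vary G h e) x))
    (hx : x ∈ U) :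
    HasDerivAt (fun e => volDensity (symPart (vary G h e)) x * L (vary G h e) x)
      (volDensity (symPart G) x * deriv (fun e => L (vary G h e) x) 0
        - volDensity (symPart G) x * pairing (((1 / 2) * L G x) • symPart G x) (h x)) 0 := by
  have h1 := (hG.hasDerivAt_volDensity_vary hh hx).mul
    (hL.hasDerivAt (e := 0) hU ⟨by linarith, hδ⟩ hx)
  refine h1.congr_deriv ?_
  rw [vary_zero, pairing_smul, dt]
  ring

/-- The Einstein tensor appears here: varying `g^{ij}` gives the Ricci term, varying `√|g|` gives
`-½ R g_{ij}`, and `δR_{ij}` contributes only a divergence. -/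
theorem dt_volDensity_mul_scalarCurv_vary (hG : IsGeneralizedMetric U G) (hU : IsOpen U)
    (hh : IsVariation U h) (hδ0 : 0 < δ)
    (hδ : ∀ e ∈ Set.Ioo (-δ) δ, ∀ x ∈ U, ((symPart G x)⁻¹ + e • h x).det ≠ 0) (hx : x ∈ U) :
    dt (fun e y => volDensity (symPart (vary G h e)) y * scalarCurv (symPart (vary G h e)) y) 0 x
      = volDensity (symPart G) x * pairing
          (ricciAt (symPart G) x - ((1 / 2) * scalarCurv (symPart G) x) • symPart G x) (h x)
        + ∑ a, pd a (palatiniCurrent (fun e => symPart (vary G h e)) 0 a) x := by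
  have h0 : (0 : ℝ) ∈ Set.Ioo (-δ) δ := ⟨by linarith, hδ0⟩
  rw [(hG.smoothMetricFam hU hh hδ).dt_volDensity_mul_scalarCurv hU h0 hx, vary_zero]
  congr 1
  have hD : ∀ i j, dt (fun e y => invDensity (symPart (vary G h e)) y i j) 0 x
      = -(1 / 2) * volDensity (symPart G) x * pairing (symPart G x) (h x) * (symPart G x)⁻¹ i j
        + volDensity (symPart G) x * h x i j := fun i j => by
    refine ((hG.hasDerivAt_volDensity_vary hh hx).mul
      (hG.hasDerivAt_inv_symPart_vary hh hδ0 hδ hx i j)).deriv.trans ?_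
    rw [vary_zero]
  have e1 : ∀ i j, (-(1 / 2) * volDensity (symPart G) x * pairing (symPart G x) (h x)
      * (symPart G x)⁻¹ i j + volDensity (symPart G) x * h x i j) * ricci (symPart G) x i j
      = -(1 / 2) * volDensity (symPart G) x * pairing (symPart G x) (h x)
          * ((symPart G x)⁻¹ i j * ricci (symPart G) x i j)
        + volDensity (symPart G) x * (ricciAt (symPart G) x i j * h x i j) := fun i j => by
    rw [ricciAt, Matrix.of_apply]
    ring
  simp only [hD, e1, Finset.sum_add_distrib, ← Finset.mul_sum]
  rw [pairing_sub, pairing_smul]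
  change _ * scalarCurv (symPart G) x + _ * pairing (ricciAt (symPart G) x) (h x) = _
  ring

/-- The energy-momentum tensor `-V_{ij} + g_{ij} L / 2`. -/
def energyMomentum (G : Field2) (L : Lagrangian) (V : Field2) : Field2 := fun x =>
  -V x + ((1 / 2) * L G x) • symPart G x

/-- The variational derivative `R_{ij} - R g_{ij} / 2 + Λ g_{ij} - T_{ij}` of the action. -/
def actionGradient (Λ : ℝ) (G : Field2) (L : Lagrangian) (V : Field2) : Field2 := fun x =>
  ricciAt (symPart G) x - ((1 / 2) * scalarCurv (symPart G) x) • symPart G x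
    + Λ • symPart G x - energyMomentum G L V x

theorem isSymmField_energyMomentum (hG : IsGeneralizedMetric U G)
    (hL : IsSmoothLagrangian U G L) (hV : IsSymmField U V) :
    IsSymmField U (energyMomentum G L V) where
  cont := fun i j => (hV.cont i j).neg.add
    ((continuousOn_const.mul hL.continuousOn).mul (hG.contDiffOn_symPart i j).continuousOn)
  symm := fun x hx => by
    rw [Matrix.IsSymm, energyMomentum, Matrix.transpose_add, Matrix.transpose_neg,
      Matrix.transpose_smul, (hV.symm x hx).eq, (symPart_isSymm G x).eq]

theorem isSymmField_actionGradient (hU : IsOpen U) (hG : IsGeneralizedMetric U G)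
    (hL : IsSmoothLagrangian U G L) (hV : IsSymmField U V) :
    IsSymmField U (actionGradient Λ G L V) where
  cont := fun i j => by
    have h0 : (0 : ℝ) ∈ Set.Ioo (-1 : ℝ) 1 := by norm_num
    have hg := (hG.contDiffOn_symPart i j).continuousOn
    have hR := (hG.smoothMetricFam_const.ricci hU i j).continuousOn h0
    have hS := (hG.smoothMetricFam_const.scalarCurv hU).continuousOn h0
    exact ((hR.sub ((continuousOn_const.mul hS).mul hg)).add (continuousOn_const.mul hg)).sub
      ((isSymmField_energyMomentum hG hL hV).cont i j)
  symm := fun x hx => by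
    have hR : (ricciAt (symPart G) x).transpose = ricciAt (symPart G) x := by
      ext i j
      exact hG.smoothMetricFam_const.ricci_symm (e := 0) hU (by norm_num) hx j i
    rw [Matrix.IsSymm, actionGradient, Matrix.transpose_sub, Matrix.transpose_add,
      Matrix.transpose_sub, Matrix.transpose_smul, Matrix.transpose_smul, (symPart_isSymm G x).eq,
      hR, ((isSymmField_energyMomentum hG hL hV).symm x hx).eq]

theorem IsVariation.continuousOn (hh : IsVariation U h) (i j : Fin 4) :
    ContinuousOn (fun x => h x i j) U :=
  (hh.smooth i j).continuous.continuousOn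

theorem integrableOn_volDensity_mul_pairing (hG : IsGeneralizedMetric U G)
    (hh : IsVariation U h) (hK : IsCompact K) (hKU : K ⊆ U) {A : Field2}
    (hA : ∀ i j, ContinuousOn (fun x => A x i j) U) :
    IntegrableOn (fun x => volDensity (symPart G) x * pairing (A x) (h x)) K :=
  integrableOn_of_continuousOn
    (hG.continuousOn_volDensity.mul (continuousOn_pairing hA hh.continuousOn)) hK hKU

theorem integrableOn_volDensity_mul_deriv (hU : IsOpen U) (hG : IsGeneralizedMetric U G)
    (hK : IsCompact K) (hKU : K ⊆ U) (hδ : 0 < δ)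
    (hL : SmoothFam δ U (fun e x => L (vary G h e) x)) :
    IntegrableOn
      (fun x => volDensity (symPart G) x * deriv (fun e => L (vary G h e) x) 0) K :=
  integrableOn_of_continuousOn (hG.continuousOn_volDensity.mul
    ((hL.dt hU).continuousOn (e := 0) ⟨by linarith, hδ⟩)) hK hKU

theorem isEnergyMomentum_energyMomentum (hU : IsOpen U) (hG : IsGeneralizedMetric U G)
    (hL : IsSmoothLagrangian U G L) (hV : IsVariationalDerivative U G L V) :
    IsEnergyMomentum U G L (energyMomentum G L V) where
  field := isSymmField_energyMomentum hG hL hV.field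
  variation := fun h hh K hK hhK hKU => by
    obtain ⟨δ, hδ0, -, hγ, hLδ⟩ := hG.exists_smoothFam hU hL hh
    have hg : ∀ i j, ContinuousOn (fun x => (((1 / 2) * L G x) • symPart G x) i j) U :=
      fun i j => (continuousOn_const.mul hL.continuousOn).mul
        (hG.contDiffOn_symPart i j).continuousOn
    refine (((hγ.volDensity hU).mul hLδ).hasDerivAt_setIntegral hδ0 hU hK hKU).congr_deriv ?_
    refine (setIntegral_congr_fun hK.measurableSet fun x hx =>
      (hasDerivAt_volDensity_mul_lagrangian hG hU hh hδ0 hLδ (hKU hx)).deriv).trans ?_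
    rw [integral_sub (integrableOn_volDensity_mul_deriv hU hG hK hKU hδ0 hLδ)
        (integrableOn_volDensity_mul_pairing hG hh hK hKU hg),
      -- The replacement by `V` is legitimate only after integration, hence the splitting of the
      -- integral before it and the recombination after it.
      hV.variation h hh K hK hhK hKU,
      ← integral_sub (integrableOn_volDensity_mul_pairing hG hh hK hKU hV.field.cont)
        (integrableOn_volDensity_mul_pairing hG hh hK hKU hg), ← integral_neg]
    congr 1
    funext x
    rw [energyMomentum, pairing_add, pairing_neg]
    ring

theorem hasDerivAt_action (hU : IsOpen U) (hG : IsGeneralizedMetric U G)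
    (hL : IsSmoothLagrangian U G L) (hV : IsVariationalDerivative U G L V)
    (hh : IsVariation U h) (hK : IsCompact K) (hhK : tsupport h ⊆ K) (hKU : K ⊆ U) :
    HasDerivAt (fun e => action Λ L K (vary G h e))
      (∫ x in K, volDensity (symPart G) x * pairing (actionGradient Λ G L V x) (h x)) 0 := by
  obtain ⟨δ, hδ0, hδ, hγ, hLδ⟩ := hG.exists_smoothFam hU hL hh
  have h0 : (0 : ℝ) ∈ Set.Ioo (-δ) δ := ⟨by linarith, hδ0⟩
  -- The cosmological term is absorbed into the Lagrangian. Its parameter derivative is unchanged,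
  -- and the volume variation of `-2Λ` supplies the term `Λ g_{ij}`.
  set L' : Lagrangian := fun G x => L G x - 2 * Λ with hL'
  have hLδ' : SmoothFam δ U (fun e x => L' (vary G h e) x) := hLδ.sub (.const contDiffOn_const)
  have hdL : ∀ x, deriv (fun e => L' (vary G h e) x) 0 = deriv (fun e => L (vary G h e) x) 0 :=
    fun x => deriv_sub_const _
  have hR := (hγ.volDensity hU).mul (hγ.scalarCurv hU)
  have hM := (hγ.volDensity hU).mul hLδ'
  have hfun : (fun e => action Λ L K (vary G h e)) = fun e => ∫ x in K,
      (volDensity (symPart (vary G h e)) x * scalarCurv (symPart (vary G h e)) x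
        + volDensity (symPart (vary G h e)) x * L' (vary G h e) x) := by
    funext e
    refine setIntegral_congr_fun hK.measurableSet fun x _ => ?_
    simp only [hL']
    ring
  rw [hfun]
  refine ((hR.add hM).hasDerivAt_setIntegral hδ0 hU hK hKU).congr_deriv ?_
  set W := fun a => palatiniCurrent (fun e => symPart (vary G h e)) 0 a with hW
  set T : Field2 := fun x => ricciAt (symPart G) x
    - ((1 / 2) * scalarCurv (symPart G) x) • symPart G x - ((1 / 2) * L' G x) • symPart G x
    with hT
  have hpt : ∀ x ∈ K, dt (fun e x =>
      volDensity (symPart (vary G h e)) x * scalarCurv (symPart (vary G h e)) x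
        + volDensity (symPart (vary G h e)) x * L' (vary G h e) x) 0 x
      = volDensity (symPart G) x * pairing (T x) (h x)
        + volDensity (symPart G) x * deriv (fun e => L (vary G h e) x) 0
        + ∑ a, pd a (W a) x := fun x hx => by
    have h1 := hR.hasDerivAt hU h0 (hKU hx)
    rw [dt_volDensity_mul_scalarCurv_vary hG hU hh hδ0 hδ (hKU hx)] at h1
    refine (h1.add (hasDerivAt_volDensity_mul_lagrangian hG hU hh hδ0 hLδ' (hKU hx))).deriv.trans ?_
    simp only [hdL, hT, hW, pairing_sub]
    ring
  have hWc : ∀ a, SmoothFam δ U (fun e => palatiniCurrent (fun e => symPart (vary G h e)) e a) :=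
    hγ.palatiniCurrent hU
  have hW0 : ∀ a, ∫ x in K, pd a (W a) x = 0 := fun a =>
    setIntegral_pd_eq_zero hU (fun x hx =>
      (((hWc a).contDiffAt_space hU h0 hx).of_le (by simp)).contDiffWithinAt) hh.compact
      hh.support hhK (fun x hx => palatiniCurrent_eq_zero hx 0 a) a
  have hWi : ∀ a, IntegrableOn (fun x => pd a (W a) x) K := fun a =>
    integrableOn_of_continuousOn (((hWc a).pd hU a).continuousOn h0) hK hKU
  have hTc : ∀ i j, ContinuousOn (fun x => T x i j) U := fun i j => by
    have h1 : (0 : ℝ) ∈ Set.Ioo (-1 : ℝ) 1 := by norm_num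
    have hg := (hG.contDiffOn_symPart i j).continuousOn
    have hR := (hG.smoothMetricFam_const.ricci hU i j).continuousOn h1
    have hS := (hG.smoothMetricFam_const.scalarCurv hU).continuousOn h1
    exact (hR.sub ((continuousOn_const.mul hS).mul hg)).sub
      ((continuousOn_const.mul (hL.continuousOn.sub continuousOn_const)).mul hg)
  have hTi := integrableOn_volDensity_mul_pairing hG hh hK hKU hTc
  have hLi := integrableOn_volDensity_mul_deriv hU hG hK hKU hδ0 hLδ
  have hTL : IntegrableOn (fun x => volDensity (symPart G) x * pairing (T x) (h x)
      + volDensity (symPart G) x * deriv (fun e => L (vary G h e) x) 0) K := hTi.add hLi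
  rw [setIntegral_congr_fun hK.measurableSet hpt,
    integral_add hTL (integrable_finsetSum _ fun a _ => hWi a),
    integral_finsetSum _ fun a _ => hWi a, Finset.sum_congr rfl fun a _ => hW0 a,
    Finset.sum_const_zero, add_zero, integral_add hTi hLi, hV.variation h hh K hK hhK hKU,
    ← integral_add hTi (integrableOn_volDensity_mul_pairing hG hh hK hKU hV.field.cont)]
  congr 1
  funext x
  simp only [hT, hL', actionGradient, energyMomentum, pairing_add, pairing_sub, pairing_neg,
    pairing_smul]
  ring

theorem isStationary_iff (hU : IsOpen U) (hG : IsGeneralizedMetric U G)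
    (hL : IsSmoothLagrangian U G L) (hV : IsVariationalDerivative U G L V) :
    IsStationary U Λ L G ↔ ∀ x ∈ U, actionGradient Λ G L V x = 0 := by
  constructor
  · intro hs
    refine eq_zero_of_forall_setIntegral_pairing_eq_zero hU hG.continuousOn_volDensity
      (fun x hx => (volDensity_pos (hG.nondegenerate x hx)).ne')
      (isSymmField_actionGradient hU hG hL hV.field) fun h hh K hK hhK hKU => ?_
    exact (hasDerivAt_action hU hG hL hV hh hK hhK hKU).unique (hs h hh K hK hhK hKU)
  · intro h0 h hh K hK hhK hKU
    refine (hasDerivAt_action hU hG hL hV hh hK hhK hKU).congr_deriv ?_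
    refine setIntegral_eq_zero_of_forall_eq_zero fun x hx => ?_
    rw [h0 x (hKU hx)]
    simp [pairing]

theorem actionGradient_eq_zero_iff :
    actionGradient Λ G L V x = 0 ↔ EinsteinEq Λ (symPart G) V (L G) x := by
  rw [← Matrix.ext_iff]
  refine forall_congr' fun i => forall_congr' fun j => ?_
  simp only [actionGradient, energyMomentum, ricciAt, Matrix.sub_apply, Matrix.add_apply,
    Matrix.smul_apply, Matrix.of_apply, Matrix.neg_apply, Matrix.zero_apply, smul_eq_mul]
  constructor <;> intro h <;> linarith

/-- Uniqueness of derivatives equates the two integrals for every variation, and the fundamental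
lemma applies to the difference of the tensors. -/
theorem IsEnergyMomentum.unique (hU : IsOpen U) (hG : IsGeneralizedMetric U G) {T T' : Field2}
    (hT : IsEnergyMomentum U G L T) (hT' : IsEnergyMomentum U G L T') (hx : x ∈ U) :
    T x = T' x := by
  refine sub_eq_zero.1 (eq_zero_of_forall_setIntegral_pairing_eq_zero (A := fun x => T x - T' x)
    hU hG.continuousOn_volDensity (fun x hx => (volDensity_pos (hG.nondegenerate x hx)).ne')
    ⟨fun i j => (hT.field.cont i j).sub (hT'.field.cont i j), fun x hx => ?_⟩
    (fun h hh K hK hhK hKU => ?_) x hx)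
  · rw [Matrix.IsSymm, Matrix.transpose_sub, (hT.field.symm x hx).eq, (hT'.field.symm x hx).eq]
  · have h1 := (hT.variation h hh K hK hhK hKU).unique (hT'.variation h hh K hK hhK hKU)
    simp only [pairing_sub, mul_sub]
    rw [integral_sub (integrableOn_volDensity_mul_pairing hG hh hK hKU hT.field.cont)
      (integrableOn_volDensity_mul_pairing hG hh hK hKU hT'.field.cont)]
    linarith

end

/-! ### Traces, pressure and energy-density -/

section Fluid

variable {g A : Matrix (Fin 4) (Fin 4) ℝ} {u : Fin 4 → ℝ}

theorem quad_eq_pairing (A : Matrix (Fin 4) (Fin 4) ℝ) (u : Fin 4 → ℝ) :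
    quad A u = pairing A (Matrix.vecMulVec u u) := by
  simp only [quad, pairing, Matrix.vecMulVec_apply, mul_assoc]

theorem quad_comoving (A : Matrix (Fin 4) (Fin 4) ℝ) : quad A comoving = A 0 0 := by
  simp [quad, comoving, Pi.single_apply]

theorem traceWith_self (hg : g.IsSymm) (hdet : g.det ≠ 0) : traceWith g g = 4 := by
  have h : traceWith g g = (g⁻¹ * g).trace := by
    rw [Matrix.trace_mul_comm]
    simp only [traceWith, pairing, Matrix.trace, Matrix.diag_apply, Matrix.mul_apply]
    rw [Finset.sum_comm]
    refine Finset.sum_congr rfl fun j _ => Finset.sum_congr rfl fun i _ => ?_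
    rw [hg.apply j i]
  rw [h, Matrix.nonsing_inv_mul _ (isUnit_iff_ne_zero.2 hdet), Matrix.trace_one]
  simp

/-- Expanding the product gives two cross terms `-u^a u^b` and a quadratic term `+u^a u^b`, the
latter by normalization of `u`. -/
theorem sum_projector_mul_inv (hg : g.IsSymm) (hdet : g.det ≠ 0) (hu : quad g u = 1)
    (a b : Fin 4) :
    ∑ i, ∑ j, projector g u a i * projector g u b j * g⁻¹ i j = g⁻¹ a b - u a * u b := by
  have hs : ∀ i j, g⁻¹ i j = g⁻¹ j i := fun i j => by
    have : (g⁻¹).IsSymm := by rw [Matrix.IsSymm, Matrix.transpose_nonsing_inv, hg.eq]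
    exact this.apply j i
  set v : Fin 4 → ℝ := fun i => ∑ a, g i a * u a with hv
  have h1 : ∀ i, ∑ j, v j * g⁻¹ i j = u i := fun i => by
    have h : (g⁻¹).mulVec (g.mulVec u) i = u i := by
      rw [Matrix.mulVec_mulVec, Matrix.nonsing_inv_mul _ (isUnit_iff_ne_zero.2 hdet),
        Matrix.one_mulVec]
    rw [← h]
    exact Finset.sum_congr rfl fun j _ => mul_comm _ _
  have h2 : ∑ i, v i * u i = 1 := by
    rw [← hu]
    simp only [hv, quad, Finset.sum_mul]
    exact Finset.sum_congr rfl fun i _ => Finset.sum_congr rfl fun j _ => by ring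
  have h3 : ∀ i, ∑ j, projector g u b j * g⁻¹ i j = g⁻¹ i b - u b * u i := fun i => by
    have : ∀ j, projector g u b j * g⁻¹ i j
        = (if b = j then g⁻¹ i j else 0) - u b * (v j * g⁻¹ i j) := fun j => by
      simp only [projector, hv, sub_mul, ite_mul, one_mul, zero_mul]
      ring
    simp only [this, Finset.sum_sub_distrib, ← Finset.mul_sum, h1]
    simp
  have h4 : ∀ i, projector g u a i * (g⁻¹ i b - u b * u i)
      = (if a = i then g⁻¹ i b - u b * u i else 0) - u a * (v i * g⁻¹ b i)
        + u a * u b * (v i * u i) := fun i => by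
    simp only [projector, sub_mul, ite_mul, one_mul, zero_mul, hs b i]
    ring
  simp only [mul_assoc, ← Finset.mul_sum, h3]
  simp only [h4, Finset.sum_add_distrib, Finset.sum_sub_distrib, ← Finset.mul_sum, h1, h2]
  simp
  ring

/-- Moving both projectors onto the inverse metric leaves the contraction of `T` with `g^{ab} - u^a
u^b`. -/
theorem pressure_eq (hg : g.IsSymm) (hdet : g.det ≠ 0) (hu : quad g u = 1)
    (T : Matrix (Fin 4) (Fin 4) ℝ) :
    pressure g T u = (1 / 3) * (-traceWith g T + quad T u) := by
  have h : traceWith g (stress g T u) = -∑ a, ∑ b, T a b *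
      ∑ i, ∑ j, projector g u a i * projector g u b j * g⁻¹ i j := by
    simp only [traceWith, pairing, stress, Matrix.of_apply, neg_mul, Finset.sum_neg_distrib,
      Finset.sum_mul, Finset.mul_sum]
    congr 1
    rw [sum_move_first_last, sum_move_first_last]
    refine Finset.sum_congr rfl fun a _ => Finset.sum_congr rfl fun b _ =>
      Finset.sum_congr rfl fun i _ => Finset.sum_congr rfl fun j _ => by ring
  rw [pressure, h]
  simp only [sum_projector_mul_inv hg hdet hu, mul_sub, Finset.sum_sub_distrib]
  simp only [traceWith, pairing, quad, mul_assoc]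
  ring

theorem traceWith_ricciAt (g : Field2) (x : Point) :
    traceWith (g x) (ricciAt g x) = scalarCurv g x := by
  simp only [traceWith, pairing, scalarCurv, ricciAt, Matrix.of_apply, mul_comm]

theorem state_parameter_algebra {t r : ℝ} (hr : r ≠ 0) :
    (1 / 3) * (-t + r) / r = -(1 / 3) * t * r⁻¹ + 1 / 3 := by
  field_simp

theorem traceWith_energyMomentum {V T : Matrix (Fin 4) (Fin 4) ℝ} {l : ℝ} (hg : g.IsSymm)
    (hdet : g.det ≠ 0) (hT : T = -V + ((1 / 2) * l) • g) :
    traceWith g T = -traceWith g V + 2 * l := by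
  have h4 := traceWith_self hg hdet
  rw [traceWith] at h4
  rw [hT, traceWith, pairing_add, pairing_neg, pairing_smul, h4, traceWith]
  ring

/-- Pressure, energy-density and state parameter of the tensor `-V_{ij} + g_{ij} ℓ / 2`. -/
theorem fluid_of_eq {T V : Matrix (Fin 4) (Fin 4) ℝ} {l : ℝ} (hg : g.IsSymm)
    (hdet : g.det ≠ 0) (hT : T = -V + ((1 / 2) * l) • g) (hu : quad g u = 1) :
    pressure g T u = (1 / 3) * traceWith g V - (1 / 3) * quad V u - (1 / 2) * l ∧
    energyDensity T u = -quad V u + (1 / 2) * l ∧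
    (energyDensity T u ≠ 0 → stateParameter g T u
      = -(1 / 3) * (-traceWith g V + 2 * l) * (-quad V u + (1 / 2) * l)⁻¹ + 1 / 3) := by
  have ht : traceWith g T = -traceWith g V + 2 * l := traceWith_energyMomentum hg hdet hT
  have hq : quad T u = -quad V u + (1 / 2) * l := by
    rw [quad_eq_pairing] at hu
    rw [hT, quad_eq_pairing, pairing_add, pairing_neg, pairing_smul, hu, quad_eq_pairing]
    ring
  have hp := pressure_eq hg hdet hu T
  refine ⟨by rw [hp, ht, hq]; ring, hq, fun h => ?_⟩
  rw [stateParameter, hp, energyDensity, ← ht, ← hq]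
  exact state_parameter_algebra h

end Fluid

/-- The equations of equilibrium for the metric. -/
theorem equilibrium_of_einsteinEq {Λ : ℝ} {g V : Field2} {ell : Point → ℝ} {x : Point}
    {u : Fin 4 → ℝ} (hg : (g x).IsSymm) (hdet : (g x).det ≠ 0)
    (hE : EinsteinEq Λ g V ell x) (hu : quad (g x) u = 1) :
    (1 / 3) * quad (ricciAt g x) u + (1 / 6) * scalarCurv g x - Λ
      = (1 / 3) * traceWith (g x) (V x) - (1 / 3) * quad (V x) u - (1 / 2) * ell x ∧
    quad (ricciAt g x) u - (1 / 2) * scalarCurv g x + Λ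
      = -quad (V x) u + (1 / 2) * ell x := by
  -- With `T = -V + ½ ℓ g`, the field equation reads `Ric = T + (½ R - Λ) g`. Its trace gives `R =
  -- 4Λ - tr T`, and its contraction with `u` gives the energy-density equation; eliminating `tr T`
  -- between them gives the pressure equation.
  have hM : ricciAt g x
      = (-V x + ((1 / 2) * ell x) • g x) + ((1 / 2) * scalarCurv g x - Λ) • g x := by
    ext i j
    have := hE i j
    simp only [ricciAt, Matrix.of_apply, Matrix.add_apply, Matrix.neg_apply, Matrix.smul_apply,
      smul_eq_mul]
    linarith
  have ht := congrArg (traceWith (g x)) hM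
  have h4 := traceWith_self hg hdet
  rw [traceWith_ricciAt, traceWith, pairing_add, pairing_smul, ← traceWith, ← traceWith,
    traceWith_energyMomentum hg hdet rfl, h4] at ht
  have hq := congrArg (fun A => quad A u) hM
  simp only [quad_eq_pairing, pairing_add, pairing_smul, pairing_neg] at hq hu ⊢
  rw [hu] at hq
  constructor <;> linarith

end GenRiem

end

theorem mainTheorem7
    (U : Set Point) (hU : IsOpen U)
    (G : Field2) (hG : IsGeneralizedMetric U G)
    (conn : Field2 → Field3) (hconn : IsSmoothConnectionLaw U G conn)
    (u' v' w Λ : ℝ)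
    (V : Field2)
    (hV : IsVariationalDerivative U G (matterLagrangian u' v' w conn) V)
    (g : Field2) (hg : g = symPart G)
    (ell : Point → ℝ) (hell : ell = matterLagrangian u' v' w conn G) :
    -- the equations of motion of the action
    (IsStationary U Λ (matterLagrangian u' v' w conn) G ↔ ∀ x ∈ U, EinsteinEq Λ g V ell x) ∧
    -- the energy-momentum tensor exists
    (∃ T, IsEnergyMomentum U G (matterLagrangian u' v' w conn) T) ∧
    -- its components and trace, and the pressure, energy-density and state parameter
    (∀ T, IsEnergyMomentum U G (matterLagrangian u' v' w conn) T → ∀ x ∈ U,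
      (∀ i j, T x i j = -V x i j + (1 / 2) * g x i j * ell x) ∧
      traceWith (g x) (T x) = -traceWith (g x) (V x) + 2 * ell x ∧
      (∀ u : Fin 4 → ℝ, quad (g x) u = 1 →
        pressure (g x) (T x) u
          = (1 / 3) * traceWith (g x) (V x) - (1 / 3) * quad (V x) u - (1 / 2) * ell x ∧
        energyDensity (T x) u = -quad (V x) u + (1 / 2) * ell x ∧
        (energyDensity (T x) u ≠ 0 → stateParameter (g x) (T x) u
          = -(1 / 3) * (-traceWith (g x) (V x) + 2 * ell x)
              * (-quad (V x) u + (1 / 2) * ell x)⁻¹ + 1 / 3)) ∧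
      (g x 0 0 = 1 →
        pressure (g x) (T x) comoving
          = (1 / 3) * traceWith (g x) (V x) - (1 / 3) * V x 0 0 - (1 / 2) * ell x ∧
        energyDensity (T x) comoving = -V x 0 0 + (1 / 2) * g x 0 0 * ell x ∧
        (energyDensity (T x) comoving ≠ 0 → stateParameter (g x) (T x) comoving
          = -(1 / 3) * (-traceWith (g x) (V x) + 2 * ell x)
              * (-V x 0 0 + (1 / 2) * g x 0 0 * ell x)⁻¹ + 1 / 3))) ∧
    -- the equations of equilibrium for the pressure and the energy-density
    ((∀ x ∈ U, EinsteinEq Λ g V ell x) → ∀ x ∈ U,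
      (∀ u : Fin 4 → ℝ, quad (g x) u = 1 →
        (1 / 3) * quad (ricciAt g x) u + (1 / 6) * scalarCurv g x - Λ
          = (1 / 3) * traceWith (g x) (V x) - (1 / 3) * quad (V x) u - (1 / 2) * ell x ∧
        quad (ricciAt g x) u - (1 / 2) * scalarCurv g x + Λ
          = -quad (V x) u + (1 / 2) * ell x) ∧
      (g x 0 0 = 1 →
        (1 / 3) * ricci g x 0 0 + (1 / 6) * scalarCurv g x - Λ
          = (1 / 3) * traceWith (g x) (V x) - (1 / 3) * V x 0 0 - (1 / 2) * ell x ∧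
        ricci g x 0 0 - (1 / 2) * scalarCurv g x + Λ
          = -V x 0 0 + (1 / 2) * g x 0 0 * ell x)) := by
  subst hg hell
  have hL := isSmoothLagrangian_matterLagrangian hU hG hconn u' v' w
  have hT0 := isEnergyMomentum_energyMomentum hU hG hL hV
  refine ⟨?_, ⟨_, hT0⟩, fun T hT x hx => ?_, fun hE x hx => ?_⟩
  · rw [isStationary_iff hU hG hL hV]
    exact forall₂_congr fun x _ => actionGradient_eq_zero_iff
  · have hs := symPart_isSymm G x
    have hdet := hG.nondegenerate x hx
    have hTx : T x = -V x + ((1 / 2) * matterLagrangian u' v' w conn G x) • symPart G x :=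
      hT.unique hU hG hT0 hx
    refine ⟨fun i j => ?_, traceWith_energyMomentum hs hdet hTx,
      fun u hu => fluid_of_eq hs hdet hTx hu, fun h00 => ?_⟩
    · rw [hTx]
      simp only [Matrix.add_apply, Matrix.neg_apply, Matrix.smul_apply, smul_eq_mul]
      ring
    -- The comoving frame is the case of a coordinate vector, for which the normalization is `g_{00}
    -- = 1`; this also accounts for the factor `g_{00}` in front of the Lagrangian.
    · have h := fluid_of_eq hs hdet hTx ((quad_comoving _).trans h00)
      rw [quad_comoving] at h
      rwa [h00, mul_one]
  · have hs := symPart_isSymm G x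
    have hdet := hG.nondegenerate x hx
    refine ⟨fun u hu => equilibrium_of_einsteinEq hs hdet (hE x hx) hu, fun h00 => ?_⟩
    have h := equilibrium_of_einsteinEq hs hdet (hE x hx) ((quad_comoving _).trans h00)
    rw [quad_comoving, quad_comoving] at h
    rwa [h00, mul_one]
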